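/- Let $d \ge 1$ be an integer. There exist a uniformly discrete sequence $\{\lambda_n\}_{n=1}^{\infty} \subset \mathbb{R}^d$, that is, a sequence with $\inf_{n \neq m} |\lambda_m - \lambda_n| > 0$ (where $|\cdot|$ is the Euclidean norm), a function $g \in L^2(\mathbb{R}^d)$ and functions $g_n^* \in L^2(\mathbb{R}^d)$ $(n = 1, 2, \dots)$, such that every $f \in L^2(\mathbb{R}^d)$ admits the series expansion $$f(x) = \sum_{n=1}^{\infty} \langle f, g_n^* \rangle \, g(x - \lambda_n),$$ where the partial sums $\sum_{n=1}^{N} \langle f, g_n^* \rangle \, g(\cdot - \lambda_n)$ converge to $f$ in the $L^2(\mathbb{R}^d)$ norm as $N \to \infty$. Here $L^2(\mathbb{R}^d)$ is the space of complex-valued square-integrable functions with respect to Lebesgue measure, and $\langle f, h \rangle = \int_{\mathbb{R}^d} f(x) \overline{h(x)} \, dx$. -/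

import Mathlib

open MeasureTheory Filter Topology

/-- Euclidean space `ℝ^d`, with the Euclidean norm and Lebesgue measure. -/
abbrev RSpace (d : ℕ) : Type := EuclideanSpace ℝ (Fin d)

/-- The Hilbert space `L²(ℝ^d)` of complex-valued functions. -/
abbrev L2Space (d : ℕ) : Type := Lp (α := RSpace d) ℂ 2 volume

/-- A sequence in `ℝ^d` is uniformly discrete if the distances between its terms with different
indices are bounded below by a positive constant. -/
def UniformlyDiscrete {d : ℕ} (lam : ℕ → RSpace d) : Prop :=
  ∃ δ : ℝ, 0 < δ ∧ ∀ n m : ℕ, n ≠ m → δ ≤ ‖lam m - lam n‖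

/-- The translate `x ↦ g (x - a)` of `g ∈ L²(ℝ^d)`. -/
noncomputable def translateL2 {d : ℕ} (a : RSpace d) (g : L2Space d) : L2Space d :=
  Lp.compMeasurePreserving (fun x => x - a) (measurePreserving_sub_right volume a) g

theorem coeFn_translateL2 {d : ℕ} (a : RSpace d) (g : L2Space d) :
    (translateL2 a g : RSpace d → ℂ) =ᵐ[volume] fun x => g (x - a) :=
  Lp.coeFn_compMeasurePreserving g (measurePreserving_sub_right volume a)

/-- The system `(x n, y n)` is a Schauder frame of the complex Hilbert space `H`, the functionals
being given by `f ↦ ⟨f, y n⟩`: the partial sums of `∑ ⟨f, y n⟩ x n`, taken in the order of the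
indices, converge in norm to `f`, for every `f`.  The scalar product of the text is linear in its
first argument and `inner` is linear in its second one, so that `⟨f, y⟩` is `inner ℂ y f`. -/
def IsSchauderFrame {H : Type*} [NormedAddCommGroup H] [InnerProductSpace ℂ H]
    (x y : ℕ → H) : Prop :=
  ∀ f : H, Tendsto (fun N : ℕ => ∑ n ∈ Finset.range N, inner ℂ (y n) f • x n) atTop (𝓝 f)

/-! The Fourier transform turns translates of `g` into modulations of a function `G`, so it suffices
to find separated frequencies and a `G` nonzero a.e. for which the modulations of `G` form a
Schauder frame. Since `G` enters only through the weight `|G|²`, the problem concerns exponentials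
in a weighted `L²`.

The frequencies come in finite blocks with fixed coefficients. The block of index `i` sums
approximately to a trigonometric polynomial `q i`, the `q i` approximate every function infinitely
often, and partial sums inside a block stay bounded by `‖q i‖ + 2`. Such blocks suffice
(`exists_isSchauderFrame_of_blocks`): pick blocks whose sums nearly equal the elements of a Parseval
frame, correct the small error by a Neumann series, and give the remaining blocks zero functionals.

A block is built (`exists_block`) from a mean-zero polynomial `P` on the circle that is near `1` off
a small set (`exists_meanZero_trigPoly`). Multiplying an exponential by `P (ν ⟨v, t⟩)` with `ν`
large moves it to far, separated frequencies and hardly changes it off a small set. The `L²` norm of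
`P` may be large, so `q` is first cut into many equal small copies, processed one by one; a partial
sum is then close to `θ • q` with `0 ≤ θ ≤ 1`.

The approximation holds only off exceptional sets of summable measure. A weight that is tiny on each
of them, and nonzero a.e. by Borel–Cantelli (`exists_frequencies_and_weight`), makes their
contribution negligible. This weight determines `|G|²`. -/

open scoped FourierTransform SchwartzMap ContDiff

/-! ### Schauder frames from blocks in an abstract Hilbert space -/

/-- A separable Hilbert space has a sequence of unit or zero vectors which is a Parseval frame. -/
theorem exists_parseval_seq (H : Type*) [NormedAddCommGroup H] [InnerProductSpace ℂ H]
    [CompleteSpace H] [TopologicalSpace.SeparableSpace H] :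
    ∃ u : ℕ → H, (∀ k, ‖u k‖ = 1 ∨ u k = 0) ∧
      ∀ f : H, HasSum (fun k => inner ℂ (u k) f • u k) f := by
  obtain ⟨w, b, hb⟩ := exists_hilbertBasis ℂ H
  have hw : w.Countable := by
    have hon : Orthonormal ℂ ((↑) : w → H) := hb ▸ b.orthonormal
    -- Distinct orthonormal vectors are at distance `√2`, so the basis is a discrete subspace of a
    -- second countable space, hence countable.
    have hdisc : ∀ i j : w, i ≠ j → 1 ≤ dist (i : H) (j : H) := by
      intro i j hij
      have h0 : inner ℂ (i : H) (j : H) = 0 := hon.2 hij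
      have h1 := norm_sub_sq (𝕜 := ℂ) (i : H) (j : H)
      rw [h0, hon.1 i, hon.1 j] at h1
      rw [dist_eq_norm]
      norm_num at h1
      nlinarith [norm_nonneg ((i : H) - j)]
    have : Countable w := by
      have : DiscreteTopology w := by
        refine DiscreteTopology.of_forall_le_dist (r := 1) one_pos ?_
        intro i j hij
        exact hdisc i j hij
      have : SecondCountableTopology H := UniformSpace.secondCountable_of_separable H
      exact TopologicalSpace.separableSpace_iff_countable.1 inferInstance
    exact this
  have : Countable w := hw
  obtain ⟨e, he⟩ := exists_injective_nat w
  refine ⟨Function.extend e b 0, ?_, ?_⟩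
  · intro k
    by_cases hk : ∃ i, e i = k
    · obtain ⟨i, rfl⟩ := hk
      left
      rw [he.extend_apply]
      exact b.orthonormal.1 i
    · right
      rw [Function.extend_apply' _ _ _ hk]; rfl
  · intro f
    have h := b.hasSum_repr f
    rw [← he.hasSum_iff]
    · convert h using 2 with i
      simp [he.extend_apply, b.repr_apply_apply]
    · intro k hk
      rw [Function.extend_apply' _ _ _ (by simpa using hk)]
      simp

theorem StrictMono.tendsto_extend_zero {φ : ℕ → ℕ} (hφ : StrictMono φ)
    {E : Type*} [NormedAddCommGroup E] {α : ℕ → E} (hα : Tendsto α atTop (𝓝 0)) :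
    Tendsto (Function.extend φ α 0) atTop (𝓝 0) := by
  rw [Metric.tendsto_atTop] at hα ⊢
  intro ε hε
  obtain ⟨K, hK⟩ := hα ε hε
  refine ⟨φ K, fun i hi => ?_⟩
  by_cases h : ∃ k, φ k = i
  · obtain ⟨k, rfl⟩ := h
    rw [hφ.injective.extend_apply]
    exact hK k (hφ.le_iff_le.1 hi)
  · rw [Function.extend_apply' _ _ _ h]
    simpa using hε

/-- Let `Y i` be the block sums. Choosing `Y (φ k)` close to `u k` makes `f ↦ ∑ ⟨u k, f⟩ Y (φ k)` a
small perturbation `1 + R` of the identity, with inverse `S`; hence `f = ∑ ⟨u k, S f⟩ Y (φ k)`.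
Expanding each `Y (φ k)` into its terms keeps convergence, since the coefficients tend to zero while
partial sums within the chosen blocks are bounded. -/
theorem exists_isSchauderFrame_of_blocks {H : Type*} [NormedAddCommGroup H]
    [InnerProductSpace ℂ H] [CompleteSpace H] [TopologicalSpace.SeparableSpace H]
    (x : ℕ → H) (c : ℕ → ℂ) (a : ℕ → ℕ) (ha : StrictMono a) (ha0 : a 0 = 0) (q : ℕ → H)
    (hpart : ∀ i m, a i ≤ m → m ≤ a (i + 1) →
      ‖∑ n ∈ Finset.Ico (a i) m, c n • x n‖ ≤ ‖q i‖ + 2)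
    (hfull : Tendsto (fun i => ∑ n ∈ Finset.Ico (a i) (a (i + 1)), c n • x n - q i)
      atTop (𝓝 0))
    (hq : ∀ v : H, ∀ ε > 0, ∃ᶠ i in atTop, ‖q i - v‖ < ε) :
    ∃ y : ℕ → H, IsSchauderFrame x y := by
  obtain ⟨u, hu1, hu⟩ := exists_parseval_seq H
  have hu1' : ∀ k, ‖u k‖ ≤ 1 := fun k => by rcases hu1 k with h | h <;> simp [h]
  set Y : ℕ → H := fun i => ∑ n ∈ Finset.Ico (a i) (a (i + 1)), c n • x n with hY
  -- The bound on `‖q i‖` is recorded because with `hpart` it bounds all partial sums of the chosen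
  -- blocks by `4`; the factors `(1 / 4) * (1 / 2) ^ k` add up to `1 / 2 < 1`.
  have hfreq : ∀ k : ℕ, ∃ᶠ i in atTop, ‖Y i - u k‖ < (1 / 4) * (1 / 2) ^ k ∧ ‖q i‖ ≤ 2 := by
    intro k
    have hpos : (0 : ℝ) < (1 / 8) * (1 / 2) ^ k := by positivity
    have h1 := hq (u k) _ hpos
    have h2 : ∀ᶠ i in atTop, ‖Y i - q i‖ < (1 / 8) * (1 / 2) ^ k := by
      have := (tendsto_zero_iff_norm_tendsto_zero.1 hfull).eventually (gt_mem_nhds hpos)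
      simpa [hY] using this
    refine (h1.and_eventually h2).mono ?_
    rintro i ⟨h3, h4⟩
    have hle : (1 / 8 : ℝ) * (1 / 2) ^ k ≤ 1 := by
      have : ((1 : ℝ) / 2) ^ k ≤ 1 := pow_le_one₀ (by norm_num) (by norm_num)
      linarith
    constructor
    · calc ‖Y i - u k‖ = ‖(Y i - q i) + (q i - u k)‖ := by congr 1; abel
        _ ≤ ‖Y i - q i‖ + ‖q i - u k‖ := norm_add_le _ _
        _ < _ := by linarith
    · calc ‖q i‖ = ‖(q i - u k) + u k‖ := by congr 1; abel
        _ ≤ ‖q i - u k‖ + ‖u k‖ := norm_add_le _ _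
        _ ≤ 2 := by linarith [hu1' k]
  obtain ⟨φ, hφ, hφY⟩ := extraction_forall_of_frequently hfreq
  set Rk : ℕ → H →L[ℂ] H := fun k => (innerSL ℂ (u k)).smulRight (Y (φ k) - u k) with hRk
  have hRkn : ∀ k, ‖Rk k‖ ≤ (1 / 4) * (1 / 2) ^ k := by
    intro k
    rw [hRk]
    simp only [ContinuousLinearMap.norm_smulRight_apply, innerSL_apply_norm]
    calc ‖u k‖ * ‖Y (φ k) - u k‖ ≤ 1 * ‖Y (φ k) - u k‖ := by gcongr; exact hu1' k
      _ ≤ _ := by linarith [(hφY k).1]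
  have hgeo : HasSum (fun k : ℕ => (1 / 4 : ℝ) * (1 / 2) ^ k) (1 / 2) := by
    have := (hasSum_geometric_of_lt_one (r := (1 / 2 : ℝ)) (by norm_num) (by norm_num)).mul_left
      (1 / 4 : ℝ)
    rwa [show (1 / 4 : ℝ) * (1 - 1 / 2)⁻¹ = 1 / 2 by norm_num] at this
  have hRs : Summable Rk := Summable.of_norm_bounded hgeo.summable hRkn
  set R : H →L[ℂ] H := ∑' k, Rk k with hR
  have hRn : ‖-R‖ < 1 := by
    rw [norm_neg]
    exact (tsum_of_norm_bounded hgeo hRkn).trans_lt (by norm_num)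
  set U := Units.oneSub (-R) hRn with hU
  set S : H →L[ℂ] H := ↑U⁻¹ with hS
  have hTS : ∀ f, S f + R (S f) = f := by
    intro f
    have h1 : (U : H →L[ℂ] H) * S = 1 := U.mul_inv
    have h2 := congrArg (fun A : H →L[ℂ] H => A f) h1
    simpa [hU, Units.val_oneSub, sub_neg_eq_add] using h2
  have hsum : ∀ f, HasSum (fun k => inner ℂ (u k) (S f) • Y (φ k)) f := by
    intro f
    have h1 := hu (S f)
    have h2 : HasSum (fun k => Rk k (S f)) (R (S f)) := by
      simpa using hRs.hasSum.mapL (ContinuousLinearMap.apply ℂ H (S f))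
    have h3 := h1.add h2
    rw [hTS] at h3
    exact h3.congr_fun fun k => by simp [hRk, smul_sub]
  have hcoef : ∀ f, Tendsto (fun k => (inner ℂ (u k) f : ℂ)) atTop (𝓝 0) := by
    intro f
    have h1 := (hu f).summable.tendsto_atTop_zero
    rw [tendsto_zero_iff_norm_tendsto_zero] at h1 ⊢
    refine h1.congr fun k => ?_
    rcases hu1 k with h | h <;> simp [norm_smul, h]
  -- `J n` will be the index of the block containing `n`.
  have hJex : ∀ n, ∃ j, a j ≤ n ∧ n < a (j + 1) := by
    intro n
    have hP : ∃ j, n < a (j + 1) := ⟨n, (Nat.lt_succ_self n).trans_le ha.le_apply⟩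
    classical
    refine ⟨Nat.find hP, ?_, Nat.find_spec hP⟩
    rcases h : Nat.find hP with _ | j
    · simp [ha0]
    · have := Nat.find_min hP (m := j) (by omega)
      omega
  choose J hJ1 hJ2 using hJex
  have hJu : ∀ i n, a i ≤ n → n < a (i + 1) → J n = i := by
    intro i n h1 h2
    have h3 := ha.lt_iff_lt.1 ((hJ1 n).trans_lt h2)
    have h4 := ha.lt_iff_lt.1 (h1.trans_lt (hJ2 n))
    omega
  have hJt : Tendsto J atTop atTop := by
    rw [tendsto_atTop]
    intro b
    filter_upwards [eventually_ge_atTop (a b)] with n hn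
    have := ha.lt_iff_lt.1 (hn.trans_lt (hJ2 n))
    omega
  -- The conjugate cancels the conjugate-linearity of `inner` in its first slot, and the adjoint
  -- moves `S` onto `f`. Off the range of `φ` the functionals vanish.
  refine ⟨fun n => (starRingEnd ℂ) (c n) •
    Function.extend φ (fun k => ContinuousLinearMap.adjoint S (u k)) 0 (J n), ?_⟩
  intro f
  set α : ℕ → ℂ := fun k => inner ℂ (u k) (S f) with hα
  set β : ℕ → ℂ := Function.extend φ α 0 with hβ
  have hterm : ∀ n, (inner ℂ ((starRingEnd ℂ) (c n) •
      Function.extend φ (fun k => ContinuousLinearMap.adjoint S (u k)) 0 (J n)) f : ℂ) • x n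
        = β (J n) • c n • x n := by
    intro n
    rw [smul_smul]
    congr 1
    rw [inner_smul_left, Complex.conj_conj, mul_comm]
    congr 1
    by_cases h : ∃ k, φ k = J n
    · obtain ⟨k, hk⟩ := h
      rw [← hk, hβ, hφ.injective.extend_apply, hφ.injective.extend_apply,
        ContinuousLinearMap.adjoint_inner_left]
    · rw [hβ, Function.extend_apply' _ _ _ h, Function.extend_apply' _ _ _ h]
      simp
  simp_rw [hterm]
  have hblock : ∀ i m, a i ≤ m → m ≤ a (i + 1) →
      ∑ n ∈ Finset.Ico (a i) m, β (J n) • c n • x n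
        = β i • ∑ n ∈ Finset.Ico (a i) m, c n • x n := by
    intro i m h1 h2
    rw [Finset.smul_sum]
    refine Finset.sum_congr rfl fun n hn => ?_
    rw [Finset.mem_Ico] at hn
    rw [hJu i n hn.1 (by omega)]
  have hranges : ∀ I, ∑ n ∈ Finset.range (a I), β (J n) • c n • x n
      = ∑ i ∈ Finset.range I, β i • Y i := by
    intro I
    induction I with
    | zero => simp [ha0]
    | succ I ih =>
      rw [Finset.sum_range_succ, ← ih, ← hblock I _ (ha.monotone (Nat.le_succ I)) le_rfl,
        Finset.sum_range_add_sum_Ico _ (ha.monotone (Nat.le_succ I))]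
  have hlim1 : Tendsto (fun I => ∑ i ∈ Finset.range I, β i • Y i) atTop (𝓝 f) := by
    apply HasSum.tendsto_sum_nat
    rw [← hφ.injective.hasSum_iff]
    · convert hsum f using 2 with k
      simp [hβ, hφ.injective.extend_apply, hα]
    · intro k hk
      rw [hβ, Function.extend_apply' _ _ _ (by simpa using hk)]
      simp
  have hβ0 : Tendsto β atTop (𝓝 0) :=
    StrictMono.tendsto_extend_zero hφ (hcoef (S f))
  have hrest : ∀ N, ‖∑ n ∈ Finset.Ico (a (J N)) N, β (J n) • c n • x n‖ ≤ ‖β (J N)‖ * 4 := by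
    intro N
    rw [hblock (J N) N (hJ1 N) (hJ2 N).le, norm_smul]
    by_cases h : ∃ k, φ k = J N
    · obtain ⟨k, hk⟩ := h
      have h1 := hpart (J N) N (hJ1 N) (hJ2 N).le
      have h2 := (hφY k).2
      rw [hk] at h2
      gcongr
      linarith
    · rw [hβ, Function.extend_apply' _ _ _ h]
      simp
  have hrest0 : Tendsto (fun N => ∑ n ∈ Finset.Ico (a (J N)) N, β (J n) • c n • x n)
      atTop (𝓝 0) := by
    refine squeeze_zero_norm hrest ?_
    have := (hβ0.comp hJt).norm.mul_const 4
    simpa using this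
  have := (hlim1.comp hJt).add hrest0
  rw [add_zero] at this
  refine this.congr fun N => ?_
  simp only [Function.comp]
  rw [← hranges, Finset.sum_range_add_sum_Ico _ (hJ1 N)]

/-! ### Equidistribution of `ν ⟨v, t⟩` on the circle -/

theorem fourier_coe_eq_fourierChar (k : ℤ) (x : ℝ) :
    fourier k (x : UnitAddCircle) = (Real.fourierChar (k * x) : ℂ) := by
  rw [fourier_coe_apply, Real.fourierChar_apply]
  congr 1
  push_cast
  ring

/-- For `k ≠ 0` this is the Riemann–Lebesgue lemma for the density of `μ`, at the frequency `-(k ν)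
v`, which tends to infinity. -/
theorem tendsto_integral_fourier_comp {d : ℕ} (μ : Measure (RSpace d)) [IsProbabilityMeasure μ]
    (hμ : μ ≪ volume) {v : RSpace d} (hv : v ≠ 0) (k : ℤ) :
    Tendsto (fun ν : ℕ => ∫ t, fourier k (((ν : ℝ) * inner ℝ v t : ℝ) : UnitAddCircle) ∂μ) atTop
      (𝓝 (∫ θ, fourier k θ ∂(AddCircle.haarAddCircle (T := 1)))) := by
  by_cases hk : k = 0
  · subst hk
    simp
  have h0 : ∫ θ, fourier k θ ∂(AddCircle.haarAddCircle (T := 1)) = 0 := by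
    have h := (fourierCoeff_fourier (T := 1) k)
    have h1 := congrFun h 0
    rw [fourierCoeff] at h1
    simpa [Pi.single_apply, hk, Ne.symm hk] using h1
  rw [h0]
  have hRL := tendsto_integral_exp_inner_smul_cocompact (V := RSpace d)
    (fun t => (((μ.rnDeriv volume t).toReal : ℝ) : ℂ))
  have hw : Tendsto (fun ν : ℕ => (-(k * ν : ℝ)) • v) atTop (cocompact (RSpace d)) := by
    rw [← Metric.cobounded_eq_cocompact, ← tendsto_norm_atTop_iff_cobounded]
    have : ∀ ν : ℕ, ‖(-(k * ν : ℝ)) • v‖ = (ν : ℝ) * (|(k : ℝ)| * ‖v‖) := by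
      intro ν
      rw [norm_smul, norm_neg, norm_mul]
      simp only [Real.norm_eq_abs, Nat.abs_cast]
      ring
    simp_rw [this]
    refine tendsto_natCast_atTop_atTop.atTop_mul_const ?_
    have : (0 : ℝ) < |(k : ℝ)| := abs_pos.2 (by exact_mod_cast hk)
    positivity
  refine (hRL.comp hw).congr fun ν => ?_
  simp only [Function.comp]
  rw [← integral_rnDeriv_smul hμ]
  refine integral_congr_ae (ae_of_all _ fun t => ?_)
  simp only
  rw [fourier_coe_eq_fourierChar, inner_smul_right, real_inner_comm, Circle.smul_def,
    smul_eq_mul, mul_comm, Complex.real_smul]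
  congr 4
  ring

/-- The characters are handled by Riemann–Lebesgue; their span is uniformly dense, and both sides
are contractions for the sup norm. -/
theorem tendsto_integral_comp_addCircle {d : ℕ} (μ : Measure (RSpace d)) [IsProbabilityMeasure μ]
    (hμ : μ ≪ volume) {v : RSpace d} (hv : v ≠ 0) (F : C(UnitAddCircle, ℂ)) :
    Tendsto (fun ν : ℕ => ∫ t, F (((ν : ℝ) * inner ℝ v t : ℝ) : UnitAddCircle) ∂μ) atTop
      (𝓝 (∫ θ, F θ ∂(AddCircle.haarAddCircle (T := 1)))) := by
  have hcont : ∀ ν : ℕ, Continuous fun t : RSpace d =>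
      (((ν : ℝ) * inner ℝ v t : ℝ) : UnitAddCircle) := fun ν =>
    (AddCircle.continuous_mk' 1).comp (by fun_prop)
  have hbd : ∀ (F : C(UnitAddCircle, ℂ)) (ν : ℕ), Integrable (fun t : RSpace d =>
      F (((ν : ℝ) * inner ℝ v t : ℝ) : UnitAddCircle)) μ := by
    intro F ν
    refine Integrable.of_bound (C := ‖F‖)
      ((F.continuous.comp (hcont ν)).aestronglyMeasurable) ?_
    exact ae_of_all _ fun t => F.norm_coe_le_norm _
  have hbc : ∀ F : C(UnitAddCircle, ℂ), Integrable F (AddCircle.haarAddCircle (T := 1)) := by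
    intro F
    refine Integrable.of_bound (C := ‖F‖) F.continuous.aestronglyMeasurable ?_
    exact ae_of_all _ fun t => F.norm_coe_le_norm _
  have hspan : ∀ F ∈ Submodule.span ℂ (Set.range (fourier (T := 1))),
      Tendsto (fun ν : ℕ => ∫ t, F (((ν : ℝ) * inner ℝ v t : ℝ) : UnitAddCircle) ∂μ) atTop
        (𝓝 (∫ θ, F θ ∂(AddCircle.haarAddCircle (T := 1)))) := by
    intro F hF
    induction hF using Submodule.span_induction with
    | mem F hF =>
      obtain ⟨k, rfl⟩ := hF
      exact tendsto_integral_fourier_comp μ hμ hv k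
    | zero => simp
    | add F G _ _ h1 h2 =>
      have := h1.add h2
      rw [← integral_add (hbc F) (hbc G)] at this
      refine this.congr fun ν => ?_
      rw [← integral_add (hbd F ν) (hbd G ν)]
      rfl
    | smul c F _ h1 =>
      have := h1.const_mul c
      rw [← integral_const_mul] at this
      refine this.congr fun ν => ?_
      rw [← integral_const_mul]
      rfl
  rw [Metric.tendsto_atTop]
  intro ε hε
  have hcl : F ∈ closure (Submodule.span ℂ (Set.range (fourier (T := 1))) : Set _) := by
    have h : F ∈ (Submodule.span ℂ (Set.range (fourier (T := 1)))).topologicalClosure := by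
      rw [span_fourier_closure_eq_top]; trivial
    exact h
  obtain ⟨G, hG, hFG⟩ := Metric.mem_closure_iff.1 hcl (ε / 4) (by positivity)
  obtain ⟨N, hN⟩ := Metric.tendsto_atTop.1 (hspan G hG) (ε / 4) (by positivity)
  refine ⟨N, fun ν hν => ?_⟩
  have hpt : ∀ θ, ‖F θ - G θ‖ ≤ ε / 4 := by
    intro θ
    have := (F - G).norm_coe_le_norm θ
    rw [dist_eq_norm] at hFG
    exact this.trans hFG.le
  have h1 : ‖∫ t, F (((ν : ℝ) * inner ℝ v t : ℝ) : UnitAddCircle) ∂μ -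
      ∫ t, G (((ν : ℝ) * inner ℝ v t : ℝ) : UnitAddCircle) ∂μ‖ ≤ ε / 4 := by
    rw [← integral_sub (hbd F ν) (hbd G ν)]
    have := norm_integral_le_of_norm_le_const (μ := μ) (f := fun t =>
      F (((ν : ℝ) * inner ℝ v t : ℝ) : UnitAddCircle) - G (((ν : ℝ) * inner ℝ v t : ℝ)))
      (ae_of_all _ fun t => hpt _)
    simpa using this
  have h2 : ‖∫ θ, F θ ∂(AddCircle.haarAddCircle (T := 1)) -
      ∫ θ, G θ ∂(AddCircle.haarAddCircle (T := 1))‖ ≤ ε / 4 := by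
    rw [← integral_sub (hbc F) (hbc G)]
    have := norm_integral_le_of_norm_le_const (μ := AddCircle.haarAddCircle (T := 1))
      (f := fun θ => F θ - G θ) (ae_of_all _ fun t => hpt _)
    simpa using this
  have h3 := hN ν hν
  rw [← dist_eq_norm] at h1 h2
  rw [dist_comm] at h2
  have h4 := dist_triangle4 (∫ t, F (((ν : ℝ) * inner ℝ v t : ℝ) : UnitAddCircle) ∂μ)
    (∫ t, G (((ν : ℝ) * inner ℝ v t : ℝ) : UnitAddCircle) ∂μ)
    (∫ θ, G θ ∂(AddCircle.haarAddCircle (T := 1)))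
    (∫ θ, F θ ∂(AddCircle.haarAddCircle (T := 1)))
  linarith

theorem tendsto_integral_comp_addCircle_real {d : ℕ} (μ : Measure (RSpace d))
    [IsProbabilityMeasure μ] (hμ : μ ≪ volume) {v : RSpace d} (hv : v ≠ 0)
    (F : C(UnitAddCircle, ℝ)) :
    Tendsto (fun ν : ℕ => ∫ t, F (((ν : ℝ) * inner ℝ v t : ℝ) : UnitAddCircle) ∂μ) atTop
      (𝓝 (∫ θ, F θ ∂(AddCircle.haarAddCircle (T := 1)))) := by
  have h := tendsto_integral_comp_addCircle μ hμ hv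
    ⟨fun θ => ((F θ : ℝ) : ℂ), by fun_prop⟩
  simp only [ContinuousMap.coe_mk, integral_complex_ofReal] at h
  exact (Complex.continuous_re.tendsto _).comp h

/-! ### Parseval, bumps and mean-zero polynomials on the circle -/

theorem integral_norm_sq_sum_fourier (t : Finset ℤ) (p : ℤ → ℂ) :
    ∫ θ, ‖∑ k ∈ t, p k * fourier k θ‖ ^ 2 ∂(AddCircle.haarAddCircle (T := 1))
      = ∑ k ∈ t, ‖p k‖ ^ 2 := by
  have hon := orthonormal_fourier (T := 1)
  set S : Lp ℂ 2 (AddCircle.haarAddCircle (T := 1)) := ∑ k ∈ t, p k • fourierLp 2 k with hS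
  have h1 : (inner ℂ S S : ℂ) = ∑ k ∈ t, (starRingEnd ℂ) (p k) * p k := hon.inner_sum p p t
  have h2 : (S : UnitAddCircle → ℂ) =ᵐ[AddCircle.haarAddCircle (T := 1)]
      fun θ => ∑ k ∈ t, p k * fourier k θ := by
    have hS' : S = ContinuousMap.toLp 2 (AddCircle.haarAddCircle (T := 1)) ℂ
        (∑ k ∈ t, p k • fourier k) := by
      simp [hS, fourierLp, map_sum]
    rw [hS']
    refine (ContinuousMap.coeFn_toLp _ _).trans (ae_of_all _ fun θ => ?_)
    simp [ContinuousMap.sum_apply]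
  rw [L2.inner_def] at h1
  have h3 : ∫ θ, (inner ℂ (S θ) (S θ) : ℂ) ∂(AddCircle.haarAddCircle (T := 1))
      = ((∫ θ, ‖∑ k ∈ t, p k * fourier k θ‖ ^ 2 ∂(AddCircle.haarAddCircle (T := 1)) : ℝ) : ℂ) := by
    rw [← integral_complex_ofReal]
    refine integral_congr_ae ?_
    filter_upwards [h2] with θ hθ
    rw [hθ, inner_self_eq_norm_sq_to_K]
    simp
  rw [h3] at h1
  have h4 : (∑ k ∈ t, (starRingEnd ℂ) (p k) * p k) = ((∑ k ∈ t, ‖p k‖ ^ 2 : ℝ) : ℂ) := by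
    push_cast
    exact Finset.sum_congr rfl fun k _ => RCLike.conj_mul _
  rw [h4] at h1
  exact_mod_cast h1

theorem haarAddCircle_closedBall {ρ : ℝ} (h0 : 0 ≤ ρ) (hρ : 2 * ρ ≤ 1) :
    (AddCircle.haarAddCircle (T := 1)).real (Metric.closedBall 0 ρ) = 2 * ρ := by
  have h1 : (volume : Measure UnitAddCircle) = AddCircle.haarAddCircle (T := 1) := by
    rw [AddCircle.volume_eq_smul_haarAddCircle]; simp
  rw [← h1, Measure.real, AddCircle.volume_closedBall, min_eq_right hρ,
    ENNReal.toReal_ofReal (by positivity)]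

/-- A trapezoidal bump on the circle, supported in a ball of radius `r * δ`. -/
noncomputable def circleBump (r δ : ℝ) : C(UnitAddCircle, ℝ) :=
  ⟨fun θ => min 1 (max 0 (r - ‖θ‖ / δ)), by fun_prop⟩

theorem circleBump_apply (r δ : ℝ) (θ : UnitAddCircle) :
    circleBump r δ θ = min 1 (max 0 (r - ‖θ‖ / δ)) := rfl

theorem circleBump_nonneg (r δ : ℝ) (θ : UnitAddCircle) : 0 ≤ circleBump r δ θ :=
  le_min zero_le_one (le_max_left _ _)

theorem circleBump_le_one (r δ : ℝ) (θ : UnitAddCircle) : circleBump r δ θ ≤ 1 :=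
  min_le_left _ _

theorem ContinuousMap.integrable_haarAddCircle {E : Type*} [NormedAddCommGroup E]
    [SecondCountableTopology E] (F : C(UnitAddCircle, E)) :
    Integrable F (AddCircle.haarAddCircle (T := 1)) :=
  Integrable.of_bound (C := ‖F‖) F.continuous.aestronglyMeasurable
    (ae_of_all _ fun _ => F.norm_coe_le_norm _)

theorem integral_circleBump_le {δ : ℝ} (hδ : 0 < δ) (hδ1 : 4 * δ ≤ 1) :
    ∫ θ, circleBump 2 δ θ ∂(AddCircle.haarAddCircle (T := 1)) ≤ 4 * δ := by
  have h1 : ∀ θ, circleBump 2 δ θ ≤ (Metric.closedBall 0 (2 * δ)).indicator 1 θ := by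
    intro θ
    by_cases h : θ ∈ Metric.closedBall (0 : UnitAddCircle) (2 * δ)
    · rw [Set.indicator_of_mem h]; exact circleBump_le_one _ _ _
    · rw [Set.indicator_of_notMem h, circleBump_apply]
      rw [mem_closedBall_zero_iff, not_le] at h
      have : 2 - ‖θ‖ / δ ≤ 0 := by
        rw [sub_nonpos, le_div_iff₀ hδ]; exact h.le
      rw [max_eq_left this]
      simp
  calc ∫ θ, circleBump 2 δ θ ∂(AddCircle.haarAddCircle (T := 1))
      ≤ ∫ θ, (Metric.closedBall 0 (2 * δ)).indicator 1 θ ∂(AddCircle.haarAddCircle (T := 1)) :=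
        integral_mono (circleBump 2 δ).integrable_haarAddCircle
          ((integrable_const (1 : ℝ)).indicator Metric.isClosed_closedBall.measurableSet) h1
    _ = 4 * δ := by
        rw [integral_indicator_one Metric.isClosed_closedBall.measurableSet,
          haarAddCircle_closedBall (by positivity) (by linarith)]
        ring

theorem le_integral_circleBump {δ : ℝ} (hδ : 0 < δ) (hδ1 : 4 * δ ≤ 1) :
    δ / 2 ≤ ∫ θ, circleBump 1 δ θ ∂(AddCircle.haarAddCircle (T := 1)) := by
  have h1 : ∀ θ, (Metric.closedBall 0 (δ / 2)).indicator (fun _ => (1 / 2 : ℝ)) θ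
      ≤ circleBump 1 δ θ := by
    intro θ
    by_cases h : θ ∈ Metric.closedBall (0 : UnitAddCircle) (δ / 2)
    · rw [Set.indicator_of_mem h, circleBump_apply]
      rw [mem_closedBall_zero_iff] at h
      have : ‖θ‖ / δ ≤ 1 / 2 := by rw [div_le_iff₀ hδ]; linarith
      exact le_min (by norm_num) (le_max_of_le_right (by linarith))
    · rw [Set.indicator_of_notMem h]
      exact circleBump_nonneg _ _ _
  calc δ / 2 = ∫ θ, (Metric.closedBall 0 (δ / 2)).indicator (fun _ => (1 / 2 : ℝ)) θ
        ∂(AddCircle.haarAddCircle (T := 1)) := by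
        rw [integral_indicator_const _ Metric.isClosed_closedBall.measurableSet,
          haarAddCircle_closedBall (by positivity) (by linarith)]
        simp only [smul_eq_mul]
        ring
    _ ≤ _ := integral_mono ((integrable_const (1 / 2 : ℝ)).indicator
          Metric.isClosed_closedBall.measurableSet) (circleBump 1 δ).integrable_haarAddCircle h1

theorem sq_le_of_le_add {x b I : ℝ} (hx : 0 ≤ x) (hb : 0 ≤ b) (hbI : b ≤ 1 / I) (h : x ≤ 3 + b) :
    x ^ 2 ≤ 18 + 2 / I * b := by
  calc x ^ 2 ≤ (3 + b) ^ 2 := by gcongr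
    _ ≤ 18 + 2 * (b * b) := by nlinarith [sq_nonneg (3 - b)]
    _ ≤ 18 + 2 * (1 / I * b) := by gcongr
    _ = _ := by ring

/-- The square of `φ / I` is at most its supremum `1 / I` times itself, and `φ / I` has integral
`1`. This gives growth `1 / I` instead of `1 / I ^ 2`. -/
theorem integral_norm_sub_sq_le {φ : C(UnitAddCircle, ℝ)} {Q : C(UnitAddCircle, ℂ)} {z : ℂ} {I : ℝ}
    (hφ0 : ∀ θ, 0 ≤ φ θ) (hφ1 : ∀ θ, φ θ ≤ 1)
    (hIe : ∫ θ, φ θ ∂(AddCircle.haarAddCircle (T := 1)) = I) (hI : 0 < I) (hz : ‖z‖ ≤ 2)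
    (hQ : ∀ θ, ‖Q θ‖ ≤ 1 + φ θ / I) :
    ∫ θ, ‖z - Q θ‖ ^ 2 ∂(AddCircle.haarAddCircle (T := 1)) ≤ 18 + 2 / I := by
  have hpt : ∀ θ, ‖z - Q θ‖ ^ 2 ≤ 18 + 2 / I * (φ θ / I) := by
    intro θ
    refine sq_le_of_le_add (norm_nonneg _) (div_nonneg (hφ0 θ) hI.le)
      (div_le_div_of_nonneg_right (hφ1 θ) hI.le) ?_
    linarith [norm_sub_le z (Q θ), hQ θ]
  have hi : Integrable (fun θ => 2 / I * (φ θ / I)) (AddCircle.haarAddCircle (T := 1)) :=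
    (φ.integrable_haarAddCircle.div_const _).const_mul _
  have hc : Continuous fun θ : UnitAddCircle => ‖z - Q θ‖ ^ 2 := by fun_prop
  have hzQ : Integrable (fun θ => ‖z - Q θ‖ ^ 2) (AddCircle.haarAddCircle (T := 1)) :=
    ContinuousMap.integrable_haarAddCircle ⟨_, hc⟩
  refine (integral_mono hzQ ((integrable_const 18).add hi) hpt).trans ?_
  rw [integral_add' (integrable_const _) hi, integral_const_mul, integral_div, hIe,
    div_self hI.ne']
  simp

/-- Trigonometric polynomials without constant term which are close to `1` off a set whose
measure is small compared with the inverse of the `L²` norm of the polynomial. -/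
theorem exists_meanZero_trigPoly {ε : ℝ} (hε : 0 < ε) :
    ∃ (s : Finset ℤ) (p : ℤ → ℂ) (ψ : C(UnitAddCircle, ℝ)) (A : ℝ), 0 ∉ s ∧ 1 ≤ A ∧
      (∀ θ, 0 ≤ ψ θ) ∧
      (∀ θ : UnitAddCircle, ε < ‖∑ k ∈ s, p k * fourier k θ - 1‖ → 1 ≤ ψ θ) ∧
      ∑ k ∈ s, ‖p k‖ ^ 2 ≤ A ^ 2 ∧
      A * ∫ θ, ψ θ ∂(AddCircle.haarAddCircle (T := 1)) ≤ ε := by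
  set m := AddCircle.haarAddCircle (T := 1) with hm
  -- With bump width `δ = r ^ 2`, the `L²` norm is at most `A = 3 / r` and the exceptional set has
  -- measure at most `4 * δ`. Their product is at most `12 * r`, which is where the bound on `r`
  -- comes from.
  obtain ⟨r, hr, hr1, hr2⟩ : ∃ r : ℝ, 0 < r ∧ r ≤ 1 / 8 ∧ 12 * r ≤ ε :=
    ⟨min (1 / 8) (ε / 12), by positivity, min_le_left _ _, by
      linarith [min_le_right (1 / 8) (ε / 12)]⟩
  set δ := r ^ 2 with hδ
  have hδ0 : 0 < δ := by positivity
  have hδ1 : 4 * δ ≤ 1 := by nlinarith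
  have hδ2 : 18 * δ ≤ 1 := by nlinarith
  set I := ∫ θ, circleBump 1 δ θ ∂m with hI
  have hIδ : δ / 2 ≤ I := le_integral_circleBump hδ0 hδ1
  have hI0 : 0 < I := by linarith
  obtain ⟨η, hη0, hη1, hη2⟩ : ∃ η : ℝ, 0 < η ∧ η ≤ 1 ∧ 2 * η ≤ ε :=
    ⟨min 1 (ε / 2), by positivity, min_le_left _ _, by linarith [min_le_right 1 (ε / 2)]⟩
  -- `1 - φ` has mean zero and equals `1` off the bump. Approximating `φ` uniformly by a polynomial
  -- `Q` and removing the constant term leads to `c 0 - Q`, with `c 0` close to `1`.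
  set φ : C(UnitAddCircle, ℂ) := ⟨fun θ => ((circleBump 1 δ θ / I : ℝ) : ℂ), by fun_prop⟩ with hφ
  have hφint : ∫ θ, φ θ ∂m = 1 := by
    simp only [hφ, ContinuousMap.coe_mk]
    rw [integral_complex_ofReal, integral_div, div_self hI0.ne']
    simp
  have hφnorm : ∀ θ, ‖φ θ‖ = circleBump 1 δ θ / I := by
    intro θ
    simp only [hφ, ContinuousMap.coe_mk]
    rw [Complex.norm_real, Real.norm_of_nonneg]
    exact div_nonneg (circleBump_nonneg _ _ _) hI0.le
  have hcl : φ ∈ closure (Submodule.span ℂ (Set.range (fourier (T := 1))) : Set _) := by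
    have h : φ ∈ (Submodule.span ℂ (Set.range (fourier (T := 1)))).topologicalClosure := by
      rw [span_fourier_closure_eq_top]; trivial
    exact h
  obtain ⟨Q, hQ, hφQ⟩ := Metric.mem_closure_iff.1 hcl η hη0
  obtain ⟨c, hc⟩ := Finsupp.mem_span_range_iff_exists_finsupp.1 hQ
  have hQθ : ∀ θ, Q θ = ∑ k ∈ c.support, c k * fourier k θ := by
    intro θ
    rw [← hc, Finsupp.sum, ContinuousMap.sum_apply]
    simp
  have hQφ : ∀ θ, ‖Q θ - φ θ‖ ≤ η := by
    intro θ
    have := (Q - φ).norm_coe_le_norm θ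
    rw [dist_comm, dist_eq_norm] at hφQ
    exact this.trans hφQ.le
  have hQ0 : ∫ θ, Q θ ∂m = c 0 := by
    have hf : ∀ k : ℤ, ∫ θ, fourier k θ ∂m = if k = 0 then 1 else 0 := by
      intro k
      have h1 := congrFun (fourierCoeff_fourier (T := 1) k) 0
      rw [fourierCoeff] at h1
      simpa [Pi.single_apply, eq_comm] using h1
    simp_rw [hQθ]
    rw [integral_finsetSum]
    · simp_rw [integral_const_mul, hf]
      simp only [mul_ite, mul_one, mul_zero, Finset.sum_ite_eq', Finsupp.mem_support_iff]
      split_ifs with h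
      · rfl
      · exact (not_not.1 h).symm
    · intro k _
      exact (fourier k).integrable_haarAddCircle.const_mul _
  have hc0 : ‖c 0 - 1‖ ≤ η := by
    rw [← hQ0, ← hφint, ← integral_sub Q.integrable_haarAddCircle φ.integrable_haarAddCircle]
    have := norm_integral_le_of_norm_le_const (μ := m)
      (f := fun θ => Q θ - φ θ) (ae_of_all _ fun t => hQφ _)
    simpa using this
  have hP : ∀ θ, ∑ k ∈ c.support.erase 0, -c k * fourier k θ = c 0 - Q θ := by
    intro θ
    rw [hQθ]
    by_cases h0 : (0 : ℤ) ∈ c.support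
    · rw [← Finset.add_sum_erase _ _ h0]
      simp
    · rw [Finset.erase_eq_of_notMem h0, Finsupp.notMem_support_iff.1 h0]
      simp
  -- `circleBump 2 δ` equals `1` on the ball of radius `δ`, outside which `circleBump 1 δ` vanishes.
  refine ⟨c.support.erase 0, fun k => -c k, circleBump 2 δ, 3 / r, Finset.notMem_erase _ _, ?_,
    circleBump_nonneg _ _, ?_, ?_, ?_⟩
  · rw [le_div_iff₀ hr]; linarith
  · intro θ hθ
    rw [hP] at hθ
    by_contra hcon
    have h1 : 1 < ‖θ‖ / δ := by
      by_contra h2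
      apply hcon
      rw [circleBump_apply]
      exact le_min le_rfl (le_max_of_le_right (by linarith))
    have h2 : φ θ = 0 := by
      rw [← norm_eq_zero, hφnorm, circleBump_apply, max_eq_left (by linarith)]
      simp
    have h3 := hQφ θ
    rw [h2, sub_zero] at h3
    have h4 : ‖c 0 - Q θ - 1‖ ≤ 2 * η := by
      calc ‖c 0 - Q θ - 1‖ = ‖(c 0 - 1) - Q θ‖ := by congr 1; ring
        _ ≤ ‖c 0 - 1‖ + ‖Q θ‖ := norm_sub_le _ _
        _ ≤ _ := by linarith
    linarith
  · rw [← integral_norm_sq_sum_fourier]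
    simp_rw [hP]
    have hc0' : ‖c 0‖ ≤ 2 := by
      calc ‖c 0‖ = ‖(c 0 - 1) + 1‖ := by congr 1; ring
        _ ≤ ‖c 0 - 1‖ + ‖(1 : ℂ)‖ := norm_add_le _ _
        _ ≤ 2 := by rw [norm_one]; linarith
    calc ∫ θ, ‖c 0 - Q θ‖ ^ 2 ∂m ≤ 18 + 2 / I :=
          integral_norm_sub_sq_le (φ := circleBump 1 δ) (circleBump_nonneg 1 δ)
            (circleBump_le_one 1 δ) hI.symm hI0 hc0' fun θ => by
              calc ‖Q θ‖ = ‖(Q θ - φ θ) + φ θ‖ := by rw [sub_add_cancel]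
                _ ≤ ‖Q θ - φ θ‖ + ‖φ θ‖ := norm_add_le _ _
                _ ≤ _ := by rw [hφnorm]; linarith [hQφ θ]
      _ ≤ 1 / δ + 2 / (δ / 2) := by
          gcongr
          rw [le_div_iff₀ hδ0]; exact hδ2
      _ ≤ (3 / r) ^ 2 := by
          rw [div_pow, ← hδ]
          have : 1 / δ + 2 / (δ / 2) = 5 / δ := by field_simp; norm_num
          rw [this]
          gcongr
          norm_num
  · calc 3 / r * ∫ θ, circleBump 2 δ θ ∂m ≤ 3 / r * (4 * δ) := by
          gcongr
          exact integral_circleBump_le hδ0 hδ1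
      _ = 12 * r := by rw [hδ]; field_simp; norm_num
      _ ≤ ε := hr2

/-! ### Trigonometric polynomials on `ℝ^d` as lists of terms -/

variable {d : ℕ}

/-- The exponential `t ↦ exp (2πi ⟨s, t⟩)`. -/
noncomputable def expo (s t : RSpace d) : ℂ := (Real.fourierChar (inner ℝ s t) : ℂ)

theorem norm_expo (s t : RSpace d) : ‖expo s t‖ = 1 := Circle.norm_coe _

theorem continuous_expo (s : RSpace d) : Continuous (expo s) := by
  unfold expo
  have h : Continuous fun t : RSpace d => Real.fourierChar (inner ℝ s t) :=
    Real.continuous_fourierChar.comp (by fun_prop)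
  exact continuous_subtype_val.comp h

theorem expo_add_smul (s v t : RSpace d) (ν : ℕ) (k : ℤ) :
    expo (s + (ν * k : ℝ) • v) t
      = expo s t * fourier k (((ν : ℝ) * inner ℝ v t : ℝ) : UnitAddCircle) := by
  rw [fourier_coe_eq_fourierChar, expo, expo, inner_add_left, AddChar.map_add_eq_mul,
    real_inner_smul_left, Circle.coe_mul]
  congr 3
  ring_nf

/-- The trigonometric polynomial with a given list of frequencies and coefficients. -/
noncomputable def trig (L : List (RSpace d × ℂ)) (t : RSpace d) : ℂ :=
  (L.map fun a => a.2 * expo a.1 t).sum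

@[simp] theorem trig_nil (t : RSpace d) : trig [] t = 0 := rfl

@[simp] theorem trig_cons (a : RSpace d × ℂ) (L : List (RSpace d × ℂ)) (t : RSpace d) :
    trig (a :: L) t = a.2 * expo a.1 t + trig L t := by simp [trig]

@[simp] theorem trig_append (L M : List (RSpace d × ℂ)) (t : RSpace d) :
    trig (L ++ M) t = trig L t + trig M t := by simp [trig]

theorem continuous_trig (L : List (RSpace d × ℂ)) : Continuous (trig L) := by
  induction L with
  | nil => exact continuous_const
  | cons a L ih =>
    have : trig (a :: L) = fun t => a.2 * expo a.1 t + trig L t := by ext t; simp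
    rw [this]
    exact (continuous_const.mul (continuous_expo _)).add ih

/-- The sum of the absolute values of the coefficients. -/
noncomputable def coeffSum (L : List (RSpace d × ℂ)) : ℝ := (L.map fun a => ‖a.2‖).sum

@[simp] theorem coeffSum_nil : coeffSum ([] : List (RSpace d × ℂ)) = 0 := rfl

@[simp] theorem coeffSum_cons (a : RSpace d × ℂ) (L : List (RSpace d × ℂ)) :
    coeffSum (a :: L) = ‖a.2‖ + coeffSum L := by simp [coeffSum]

@[simp] theorem coeffSum_append (L M : List (RSpace d × ℂ)) :
    coeffSum (L ++ M) = coeffSum L + coeffSum M := by simp [coeffSum]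

theorem coeffSum_nonneg (L : List (RSpace d × ℂ)) : 0 ≤ coeffSum L := by
  induction L with
  | nil => simp
  | cons a L ih => rw [coeffSum_cons]; positivity

theorem norm_trig_le (L : List (RSpace d × ℂ)) (t : RSpace d) : ‖trig L t‖ ≤ coeffSum L := by
  induction L with
  | nil => simp
  | cons a L ih =>
    rw [trig_cons, coeffSum_cons]
    refine (norm_add_le _ _).trans ?_
    rw [norm_mul, norm_expo, mul_one]
    gcongr

theorem coeffSum_take_le (L : List (RSpace d × ℂ)) (m : ℕ) :
    coeffSum (L.take m) ≤ coeffSum L := by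
  conv_rhs => rw [← List.take_append_drop m L, coeffSum_append]
  linarith [coeffSum_nonneg (L.drop m)]

theorem norm_coeff_le_coeffSum {L : List (RSpace d × ℂ)} {a : RSpace d × ℂ} (ha : a ∈ L) :
    ‖a.2‖ ≤ coeffSum L := by
  induction L with
  | nil => simp at ha
  | cons b L ih =>
    rw [coeffSum_cons]
    rcases List.mem_cons.1 ha with rfl | h
    · linarith [coeffSum_nonneg L]
    · linarith [ih h, norm_nonneg b.2]

/-! ### Construction of one block -/

theorem eLpNorm_two_sq {α E : Type*} [MeasurableSpace α] {μ : Measure α}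
    [NormedAddCommGroup E] (f : α → E) : eLpNorm f 2 μ ^ 2 = ∫⁻ x, ‖f x‖ₑ ^ 2 ∂μ := by
  have := eLpNorm_nnreal_pow_eq_lintegral (f := f) (μ := μ) (p := 2) (by norm_num)
  simpa using this

theorem eLpNorm_two_le_of_integral_sq_le {α E : Type*} [MeasurableSpace α] {μ : Measure α}
    [NormedAddCommGroup E] {f : α → E} (hf : Integrable (fun x => ‖f x‖ ^ 2) μ) {C : ℝ}
    (hC : 0 ≤ C) (h : ∫ x, ‖f x‖ ^ 2 ∂μ ≤ C ^ 2) : eLpNorm f 2 μ ≤ ENNReal.ofReal C := by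
  have h1 : eLpNorm f 2 μ ^ 2 ≤ ENNReal.ofReal C ^ 2 := by
    rw [eLpNorm_two_sq, ← ENNReal.ofReal_pow hC]
    refine le_trans (le_of_eq ?_) (ENNReal.ofReal_le_ofReal h)
    rw [ofReal_integral_eq_lintegral_ofReal hf (ae_of_all _ fun x => by positivity)]
    refine lintegral_congr fun x => ?_
    rw [ENNReal.ofReal_pow (norm_nonneg _), ofReal_norm]
  exact (ENNReal.pow_le_pow_left_iff (by norm_num)).1 h1

theorem eLpNorm_two_restrict_le {α E : Type*} [MeasurableSpace α] {μ : Measure α}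
    [IsProbabilityMeasure μ] [NormedAddCommGroup E] {f : α → E} {s : Set α}
    (hs : MeasurableSet s) {C : ℝ} (h : ∀ x ∈ s, ‖f x‖ ≤ C) :
    eLpNorm f 2 (μ.restrict s) ≤ ENNReal.ofReal C := by
  refine (eLpNorm_le_of_ae_bound (C := C) ?_).trans ?_
  · exact (ae_restrict_iff' hs).2 (ae_of_all _ h)
  · calc _ ≤ 1 * ENNReal.ofReal C := by
          gcongr
          refine ENNReal.rpow_le_one ?_ (by positivity)
          rw [Measure.restrict_apply_univ]
          exact prob_le_one
      _ = _ := one_mul _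

/-- Approximation of a single exponential by exponentials of large frequency. -/
theorem exists_block_of_expo (μ : Measure (RSpace d)) [IsProbabilityMeasure μ]
    (hμ : μ ≪ volume) {v : RSpace d} (hv : ‖v‖ = 1) {ε A : ℝ} (hA : 1 ≤ A) (hε : 0 < ε)
    {s : Finset ℤ} {p : ℤ → ℂ} {ψ : C(UnitAddCircle, ℝ)} (hs : 0 ∉ s) (hψ0 : ∀ θ, 0 ≤ ψ θ)
    (hψ : ∀ θ : UnitAddCircle, ε < ‖∑ k ∈ s, p k * fourier k θ - 1‖ → 1 ≤ ψ θ)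
    (hp : ∑ k ∈ s, ‖p k‖ ^ 2 ≤ A ^ 2)
    (hAψ : A * ∫ θ, ψ θ ∂(AddCircle.haarAddCircle (T := 1)) ≤ ε)
    (a : RSpace d × ℂ) (prior : List (RSpace d)) :
    ∃ (B : List (RSpace d × ℂ)) (E : Set (RSpace d)), MeasurableSet E ∧
      μ E ≤ ENNReal.ofReal (2 * ε / A) ∧
      (B.map Prod.fst).Pairwise (fun x y => 1 ≤ ‖x - y‖) ∧
      (∀ x ∈ prior, ∀ y ∈ B.map Prod.fst, 1 ≤ ‖x - y‖) ∧
      (∀ t ∉ E, ‖trig B t - a.2 * expo a.1 t‖ ≤ ε * ‖a.2‖) ∧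
      ∀ m, eLpNorm (trig (B.take m)) 2 μ ≤ ENNReal.ofReal (‖a.2‖ * (2 * A)) := by
  have hv0 : v ≠ 0 := by rintro rfl; simp at hv
  have hA0 : 0 < A := by linarith
  have hcont : ∀ ν : ℕ, Continuous fun t : RSpace d =>
      (((ν : ℝ) * inner ℝ v t : ℝ) : UnitAddCircle) := fun ν =>
    (AddCircle.continuous_mk' 1).comp (by fun_prop)
  have ev1 : ∀ᶠ ν : ℕ in atTop,
      ∫ t, ψ (((ν : ℝ) * inner ℝ v t : ℝ) : UnitAddCircle) ∂μ ≤ 2 * ε / A := by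
    refine ((tendsto_integral_comp_addCircle_real μ hμ hv0 ψ).eventually_lt_const ?_).mono
      fun _ h => h.le
    rw [lt_div_iff₀ hA0]
    linarith
  have hcF : ∀ t : Finset ℤ, Continuous fun θ : UnitAddCircle =>
      ‖∑ k ∈ t, p k * fourier k θ‖ ^ 2 := by intro t; fun_prop
  -- Truncating the block selects a subset of `s`. Only finitely many subsets occur, each with
  -- limiting square norm at most `A ^ 2 < (2 * A) ^ 2`, so one `ν` serves all of them.
  have ev2 : ∀ᶠ ν : ℕ in atTop, ∀ t ∈ s.powerset,
      ∫ x, ‖∑ k ∈ t, p k * fourier k (((ν : ℝ) * inner ℝ v x : ℝ) : UnitAddCircle)‖ ^ 2 ∂μ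
        ≤ (2 * A) ^ 2 := by
    rw [eventually_all_finset]
    intro t ht
    refine ((tendsto_integral_comp_addCircle_real μ hμ hv0 ⟨_, hcF t⟩).eventually_lt_const
      (u := (2 * A) ^ 2) ?_).mono fun _ h => h.le
    simp only [ContinuousMap.coe_mk]
    rw [integral_norm_sq_sum_fourier]
    calc ∑ k ∈ t, ‖p k‖ ^ 2 ≤ ∑ k ∈ s, ‖p k‖ ^ 2 :=
          Finset.sum_le_sum_of_subset_of_nonneg (Finset.mem_powerset.1 ht) fun _ _ _ => by positivity
      _ ≤ A ^ 2 := hp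
      _ < _ := by nlinarith
  -- Since `0 ∉ s`, every new frequency `a.1 + ν k v` is at distance at least `ν` from `a.1`, hence
  -- far from the prior ones.
  have ev3 : ∀ᶠ ν : ℕ in atTop, ∀ x ∈ prior.toFinset, 1 + ‖a.1 - x‖ ≤ ν := by
    rw [eventually_all_finset]
    intro x _
    exact tendsto_natCast_atTop_atTop.eventually_ge_atTop _
  obtain ⟨ν, h1, h2, h3, h4⟩ := (ev1.and (ev2.and (ev3.and (eventually_ge_atTop 1)))).exists
  have h4' : (1 : ℝ) ≤ ν := by exact_mod_cast h4
  set f : ℤ → RSpace d × ℂ := fun k => (a.1 + (ν * k : ℝ) • v, a.2 * p k) with hf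
  have htrig : ∀ l : List ℤ, l.Nodup → ∀ t, trig (l.map f) t = a.2 * expo a.1 t *
      ∑ k ∈ l.toFinset, p k * fourier k (((ν : ℝ) * inner ℝ v t : ℝ) : UnitAddCircle) := by
    intro l hl t
    rw [Finset.mul_sum, List.sum_toFinset _ hl, trig, List.map_map]
    congr 1
    refine List.map_congr_left fun k _ => ?_
    simp only [Function.comp, hf]
    rw [expo_add_smul]
    ring
  have habs : ∀ k : ℤ, k ≠ 0 → (1 : ℝ) ≤ |(k : ℝ)| := by
    intro k hk
    exact_mod_cast Int.one_le_abs hk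
  set E : Set (RSpace d) := {t | ε < ‖∑ k ∈ s, p k *
    fourier k (((ν : ℝ) * inner ℝ v t : ℝ) : UnitAddCircle) - 1‖} with hE
  have hcP : Continuous fun θ : UnitAddCircle => ‖∑ k ∈ s, p k * fourier k θ - 1‖ := by fun_prop
  have hEm : MeasurableSet E :=
    (isOpen_lt continuous_const (hcP.comp (hcont ν))).measurableSet
  refine ⟨s.toList.map f, E, hEm, ?_, ?_, ?_, ?_, ?_⟩
  · have hint : Integrable (fun t => ψ (((ν : ℝ) * inner ℝ v t : ℝ) : UnitAddCircle)) μ :=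
      Integrable.of_bound (C := ‖ψ‖) ((ψ.continuous.comp (hcont ν)).aestronglyMeasurable)
        (ae_of_all _ fun t => ψ.norm_coe_le_norm _)
    refine le_trans ?_ (ENNReal.ofReal_le_ofReal h1)
    rw [ofReal_integral_eq_lintegral_ofReal hint (ae_of_all _ fun t => hψ0 _),
      ← lintegral_indicator_one hEm]
    refine lintegral_mono fun t => ?_
    by_cases ht : t ∈ E
    · rw [Set.indicator_of_mem ht]
      simpa using hψ _ ht
    · rw [Set.indicator_of_notMem ht]
      exact zero_le
  · rw [List.map_map, List.pairwise_map]
    refine (Finset.nodup_toList s).imp fun {k l} hkl => ?_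
    simp only [Function.comp, hf]
    rw [add_sub_add_left_eq_sub, ← sub_smul, norm_smul, hv, mul_one, ← mul_sub, norm_mul]
    have := habs (k - l) (sub_ne_zero.2 hkl)
    push_cast at this
    rw [Real.norm_eq_abs, Real.norm_eq_abs, Nat.abs_cast]
    nlinarith
  · intro x hx y hy
    rw [List.map_map, List.mem_map] at hy
    obtain ⟨k, hk, rfl⟩ := hy
    have hk0 : k ≠ 0 := by rintro rfl; exact hs (Finset.mem_toList.1 hk)
    simp only [Function.comp, hf]
    have h5 := h3 x (List.mem_toFinset.2 hx)
    have h6 := habs k hk0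
    have h7 : ‖(ν * k : ℝ) • v‖ = ν * |(k : ℝ)| := by
      rw [norm_smul, hv, mul_one, norm_mul, Real.norm_eq_abs, Real.norm_eq_abs, Nat.abs_cast]
    have h8 : ‖(ν * k : ℝ) • v‖ ≤ ‖x - (a.1 + (ν * k : ℝ) • v)‖ + ‖a.1 - x‖ := by
      rw [norm_sub_rev x]
      calc ‖(ν * k : ℝ) • v‖ = ‖(a.1 + (ν * k : ℝ) • v - x) - (a.1 - x)‖ := by congr 1; abel
        _ ≤ _ := norm_sub_le _ _
    rw [h7] at h8
    nlinarith
  · intro t ht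
    rw [htrig _ (Finset.nodup_toList s), Finset.toList_toFinset]
    rw [hE, Set.mem_ofPred_eq, not_lt] at ht
    calc _ = ‖a.2 * expo a.1 t * (∑ k ∈ s, p k *
          fourier k (((ν : ℝ) * inner ℝ v t : ℝ) : UnitAddCircle) - 1)‖ := by congr 1; ring
      _ ≤ ‖a.2‖ * ε := by rw [norm_mul, norm_mul, norm_expo, mul_one]; gcongr
      _ = _ := mul_comm _ _
  · intro m
    rw [← List.map_take]
    set l := s.toList.take m
    have hl : l.Nodup := (Finset.nodup_toList s).sublist (List.take_sublist m _)
    have hls : l.toFinset ∈ s.powerset := by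
      rw [Finset.mem_powerset]
      intro k hk
      exact Finset.mem_toList.1 (List.mem_of_mem_take (List.mem_toFinset.1 hk))
    have hn : ∀ t, ‖trig (l.map f) t‖ ^ 2 = ‖a.2‖ ^ 2 * ‖∑ k ∈ l.toFinset,
        p k * fourier k (((ν : ℝ) * inner ℝ v t : ℝ) : UnitAddCircle)‖ ^ 2 := by
      intro t
      rw [htrig l hl, norm_mul, norm_mul, norm_expo, mul_one, mul_pow]
    refine eLpNorm_two_le_of_integral_sq_le ?_ (by positivity) ?_
    · refine Integrable.of_bound (C := coeffSum (l.map f) ^ 2)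
        ((continuous_trig _).norm.pow 2).aestronglyMeasurable (ae_of_all _ fun t => ?_)
      rw [norm_pow, norm_norm]
      gcongr
      exact norm_trig_le _ _
    · simp_rw [hn]
      rw [integral_const_mul, mul_pow]
      gcongr
      exact h2 _ hls

/-- Approximation of the terms of a trigonometric polynomial one after the other. -/
theorem exists_block_of_list (μ : Measure (RSpace d)) [IsProbabilityMeasure μ]
    (hμ : μ ≪ volume) {v : RSpace d} (hv : ‖v‖ = 1) {ε A : ℝ} (hA : 1 ≤ A) (hε : 0 < ε)
    {s : Finset ℤ} {p : ℤ → ℂ} {ψ : C(UnitAddCircle, ℝ)} (hs : 0 ∉ s) (hψ0 : ∀ θ, 0 ≤ ψ θ)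
    (hψ : ∀ θ : UnitAddCircle, ε < ‖∑ k ∈ s, p k * fourier k θ - 1‖ → 1 ≤ ψ θ)
    (hp : ∑ k ∈ s, ‖p k‖ ^ 2 ≤ A ^ 2)
    (hAψ : A * ∫ θ, ψ θ ∂(AddCircle.haarAddCircle (T := 1)) ≤ ε)
    {M : ℝ} (L : List (RSpace d × ℂ)) (hM : ∀ a ∈ L, ‖a.2‖ ≤ M) (prior : List (RSpace d)) :
    ∃ (B : List (RSpace d × ℂ)) (E : Set (RSpace d)), MeasurableSet E ∧
      μ E ≤ ENNReal.ofReal (L.length * (2 * ε / A)) ∧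
      (B.map Prod.fst).Pairwise (fun x y => 1 ≤ ‖x - y‖) ∧
      (∀ x ∈ prior, ∀ y ∈ B.map Prod.fst, 1 ≤ ‖x - y‖) ∧
      (∀ t ∉ E, ‖trig B t - trig L t‖ ≤ ε * coeffSum L) ∧
      ∀ m, ∃ r, eLpNorm (fun t => trig (B.take m) t - trig (L.take r) t) 2 (μ.restrict Eᶜ)
        ≤ ENNReal.ofReal (ε * coeffSum L + M * (2 * A)) := by
  have hA0 : 0 < A := by linarith
  induction L generalizing prior with
  | nil =>
    refine ⟨[], ∅, MeasurableSet.empty, by simp, by simp, by simp, by simp, fun m => ⟨0, by simp⟩⟩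
  | cons a L ih =>
    obtain ⟨B₁, E₁, hE₁, hμ₁, hsep₁, hpr₁, hap₁, hpar₁⟩ :=
      exists_block_of_expo μ hμ hv hA hε hs hψ0 hψ hp hAψ a prior
    obtain ⟨B₂, E₂, hE₂, hμ₂, hsep₂, hpr₂, hap₂, hpar₂⟩ :=
      ih (fun b hb => hM b (List.mem_cons_of_mem _ hb)) (prior ++ B₁.map Prod.fst)
    have hEE : (E₁ ∪ E₂)ᶜ ⊆ E₁ᶜ := Set.compl_subset_compl.2 Set.subset_union_left
    have hEE' : (E₁ ∪ E₂)ᶜ ⊆ E₂ᶜ := Set.compl_subset_compl.2 Set.subset_union_right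
    have hc0 := coeffSum_nonneg L
    have ha := hM a List.mem_cons_self
    have hM0 : 0 ≤ M := (norm_nonneg _).trans ha
    refine ⟨B₁ ++ B₂, E₁ ∪ E₂, hE₁.union hE₂, ?_, ?_, ?_, ?_, ?_⟩
    · refine (measure_union_le _ _).trans ((add_le_add hμ₁ hμ₂).trans ?_)
      rw [← ENNReal.ofReal_add (by positivity) (by positivity)]
      apply ENNReal.ofReal_le_ofReal
      rw [List.length_cons]
      push_cast
      linarith
    · rw [List.map_append, List.pairwise_append]
      exact ⟨hsep₁, hsep₂, fun x hx y hy => hpr₂ x (List.mem_append_right _ hx) y hy⟩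
    · intro x hx y hy
      rw [List.map_append, List.mem_append] at hy
      rcases hy with hy | hy
      · exact hpr₁ x hx y hy
      · exact hpr₂ x (List.mem_append_left _ hx) y hy
    · intro t ht
      rw [trig_append, trig_cons, coeffSum_cons]
      have h1 := hap₁ t (hEE ht)
      have h2 := hap₂ t (hEE' ht)
      calc _ = ‖(trig B₁ t - a.2 * expo a.1 t) + (trig B₂ t - trig L t)‖ := by congr 1; ring
        _ ≤ _ := norm_add_le _ _
        _ ≤ _ := by linarith
    · intro m
      -- A truncation cuts at most one of the blocks of the single terms. Only this one costs `M *
      -- (2 * A)`; the completed ones cost `ε` times their coefficients.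
      rcases le_or_gt m B₁.length with hm | hm
      · refine ⟨0, ?_⟩
        rw [List.take_append_of_le_length hm]
        simp only [List.take_zero, trig_nil, sub_zero]
        refine (eLpNorm_mono_measure _ Measure.restrict_le_self).trans ((hpar₁ m).trans ?_)
        apply ENNReal.ofReal_le_ofReal
        rw [coeffSum_cons]
        have : 0 ≤ ε * (‖a.2‖ + coeffSum L) := by positivity
        have : ‖a.2‖ * (2 * A) ≤ M * (2 * A) := by gcongr
        linarith
      · obtain ⟨r, hr⟩ := hpar₂ (m - B₁.length)
        refine ⟨r + 1, ?_⟩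
        have heq : (fun t => trig ((B₁ ++ B₂).take m) t - trig ((a :: L).take (r + 1)) t)
            = (fun t => trig B₁ t - a.2 * expo a.1 t) +
              fun t => trig (B₂.take (m - B₁.length)) t - trig (L.take r) t := by
          ext t
          rw [List.take_append, List.take_of_length_le hm.le, List.take_succ_cons]
          simp only [trig_append, trig_cons, Pi.add_apply]
          ring
        rw [heq]
        refine (eLpNorm_add_le ?_ ?_ (by norm_num)).trans ?_
        · exact ((continuous_trig _).sub
            (continuous_const.mul (continuous_expo _))).aestronglyMeasurable
        · exact ((continuous_trig _).sub (continuous_trig _)).aestronglyMeasurable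
        · have h1 : eLpNorm (fun t => trig B₁ t - a.2 * expo a.1 t) 2 (μ.restrict (E₁ ∪ E₂)ᶜ)
              ≤ ENNReal.ofReal (ε * ‖a.2‖) :=
            eLpNorm_two_restrict_le (hE₁.union hE₂).compl fun t ht => hap₁ t (hEE ht)
          have h2 := (eLpNorm_mono_measure
            (fun t => trig (B₂.take (m - B₁.length)) t - trig (L.take r) t)
            (Measure.restrict_mono hEE' le_rfl)).trans hr
          refine (add_le_add h1 h2).trans ?_
          rw [← ENNReal.ofReal_add (by positivity) (by positivity)]
          apply ENNReal.ofReal_le_ofReal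
          rw [coeffSum_cons]
          linarith

/-- This is the source of the factor `θ = k / K` in `exists_block`: a truncation consists of `k`
whole copies and part of one more. -/
theorem trig_take_flatten_replicate (L : List (RSpace d × ℂ)) (K r : ℕ) :
    ∃ k ≤ K, ∃ j, ∀ t, trig ((List.replicate K L).flatten.take r) t
      = k * trig L t + trig (L.take j) t := by
  induction K generalizing r with
  | zero => exact ⟨0, le_rfl, 0, by simp⟩
  | succ K ih =>
    rw [List.replicate_succ, List.flatten_cons]
    rcases le_or_gt r L.length with hr | hr
    · refine ⟨0, by simp, r, fun t => ?_⟩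
      rw [List.take_append_of_le_length hr]
      simp
    · obtain ⟨k, hk, j, hj⟩ := ih (r - L.length)
      refine ⟨k + 1, by omega, j, fun t => ?_⟩
      rw [List.take_append, List.take_of_length_le hr.le, trig_append, hj]
      push_cast
      ring

theorem trig_flatten_replicate (L : List (RSpace d × ℂ)) (K : ℕ) (t : RSpace d) :
    trig (List.replicate K L).flatten t = K * trig L t := by
  induction K with
  | zero => simp
  | succ K ih =>
    rw [List.replicate_succ, List.flatten_cons, trig_append, ih]
    push_cast
    ring

theorem coeffSum_flatten_replicate (L : List (RSpace d × ℂ)) (K : ℕ) :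
    coeffSum (List.replicate K L).flatten = K * coeffSum L := by
  induction K with
  | zero => simp
  | succ K ih =>
    rw [List.replicate_succ, List.flatten_cons, coeffSum_append, ih]
    push_cast
    ring

theorem trig_map_smul (c : ℂ) (L : List (RSpace d × ℂ)) (t : RSpace d) :
    trig (L.map fun a => (a.1, c * a.2)) t = c * trig L t := by
  induction L with
  | nil => simp
  | cons a L ih => rw [List.map_cons, trig_cons, trig_cons, ih]; ring

theorem coeffSum_map_smul (c : ℂ) (L : List (RSpace d × ℂ)) :
    coeffSum (L.map fun a => (a.1, c * a.2)) = ‖c‖ * coeffSum L := by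
  induction L with
  | nil => simp
  | cons a L ih => rw [List.map_cons, coeffSum_cons, coeffSum_cons, ih, norm_mul]; ring

theorem exists_far_vector {v : RSpace d} (hv : ‖v‖ = 1) (l : List (RSpace d)) :
    ∃ w : RSpace d, ∀ x ∈ l, 1 ≤ ‖x - w‖ := by
  obtain ⟨R, hR⟩ : ∃ R : ℝ, ∀ x ∈ l.toFinset, ‖x‖ ≤ R := by
    obtain ⟨R, hR⟩ := (l.toFinset.image fun x => ‖x‖).bddAbove
    exact ⟨R, fun x hx => hR (by simpa using ⟨x, by simpa using hx, rfl⟩)⟩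
  refine ⟨(|R| + 1) • v, fun x hx => ?_⟩
  have h1 := hR x (List.mem_toFinset.2 hx)
  have h2 : ‖(|R| + 1) • v‖ = |R| + 1 := by
    rw [norm_smul, hv, mul_one, Real.norm_of_nonneg (by positivity)]
  have h3 := norm_sub_norm_le ((|R| + 1) • v) x
  rw [norm_sub_rev]
  linarith [le_abs_self R]

/-- Every trigonometric polynomial is approximated, off a set of small measure, by another one
with new separated frequencies, all of whose partial sums are close to multiples
`θ • q`, `0 ≤ θ ≤ 1`, of the given polynomial `q`. -/
theorem exists_block (hd : 1 ≤ d) (μ : Measure (RSpace d)) [IsProbabilityMeasure μ]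
    (hμ : μ ≪ volume) (q : List (RSpace d × ℂ)) {ε : ℝ} (hε : 0 < ε) (prior : List (RSpace d)) :
    ∃ (B : List (RSpace d × ℂ)) (E : Set (RSpace d)), B ≠ [] ∧ MeasurableSet E ∧
      μ E ≤ ENNReal.ofReal ε ∧
      (B.map Prod.fst).Pairwise (fun x y => 1 ≤ ‖x - y‖) ∧
      (∀ x ∈ prior, ∀ y ∈ B.map Prod.fst, 1 ≤ ‖x - y‖) ∧
      (∀ t ∉ E, ‖trig B t - trig q t‖ ≤ ε) ∧
      ∀ m, ∃ θ : ℝ, 0 ≤ θ ∧ θ ≤ 1 ∧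
        eLpNorm (fun t => trig (B.take m) t - θ * trig q t) 2 (μ.restrict Eᶜ)
          ≤ ENNReal.ofReal ε := by
  obtain ⟨v, hv⟩ : ∃ v : RSpace d, ‖v‖ = 1 :=
    ⟨EuclideanSpace.single (⟨0, hd⟩ : Fin d) 1, by simp⟩
  set C := coeffSum q + 1 with hC
  have hC0 : 0 < C := by linarith [coeffSum_nonneg q]
  have hCq : coeffSum q ≤ C := by linarith
  set J : ℝ := q.length + 1 with hJ
  have hJ0 : 0 < J := by positivity
  set N : ℝ := 12 * C / ε + 1 with hN
  have hN1 : 1 ≤ N := by rw [hN]; linarith [show 0 < 12 * C / ε by positivity]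
  have hN0 : 0 < N := by linarith
  have hCN : C / N ≤ ε / 12 := by
    rw [div_le_iff₀ hN0, hN]
    have : ε / 12 * (12 * C / ε + 1) = C + ε / 12 := by field_simp
    linarith
  -- `A` will depend on `ε'`, so `ε'` must be fixed without it. This works because about `A * N`
  -- copies are used, each term having an exceptional set of measure `2 * ε' / A`: the factor `A`
  -- cancels in the total.
  obtain ⟨ε', hε'0, hε'1, hε'2⟩ : ∃ ε' : ℝ, 0 < ε' ∧ ε' * C ≤ ε / 4 ∧ (N + 1) * J * 2 * ε' ≤ ε := by
    refine ⟨min (ε / (4 * C)) (ε / ((N + 1) * J * 2)), by positivity, ?_, ?_⟩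
    · calc _ ≤ ε / (4 * C) * C := by gcongr; exact min_le_left _ _
        _ = ε / 4 := by field_simp
    · calc _ ≤ (N + 1) * J * 2 * (ε / ((N + 1) * J * 2)) := by gcongr; exact min_le_right _ _
        _ = ε := by field_simp
  obtain ⟨s, p, ψ, A, hs, hA, hψ0, hψ, hp, hAψ⟩ := exists_meanZero_trigPoly hε'0
  have hA0 : 0 < A := by linarith
  set K := ⌈A * N⌉₊ with hK
  have hK1 : A * N ≤ K := Nat.le_ceil _
  have hK2 : (K : ℝ) ≤ A * (N + 1) := by
    have := (Nat.ceil_lt_add_one (show 0 ≤ A * N by positivity)).le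
    nlinarith
  have hK0 : (0 : ℝ) < K := lt_of_lt_of_le (by positivity) hK1
  set q' : List (RSpace d × ℂ) := q.map fun a => (a.1, (K : ℂ)⁻¹ * a.2) with hq'
  have hq't : ∀ t, trig q' t = (K : ℂ)⁻¹ * trig q t := trig_map_smul _ q
  have hq'c : coeffSum q' = coeffSum q / K := by
    rw [hq', coeffSum_map_smul, norm_inv, Complex.norm_natCast]; ring
  have hq'M : coeffSum q' ≤ C / (A * N) := by
    rw [hq'c]; gcongr
  set L := (List.replicate K q').flatten with hL
  have hLt : ∀ t, trig L t = trig q t := by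
    intro t
    have : (K : ℂ) ≠ 0 := by exact_mod_cast hK0.ne'
    rw [hL, trig_flatten_replicate, hq't, mul_inv_cancel_left₀ this]
  have hLc : coeffSum L ≤ C := by
    rw [hL, coeffSum_flatten_replicate, hq'c, mul_div_cancel₀ _ hK0.ne']
    exact hCq
  have hLc0 := coeffSum_nonneg L
  have hLM : ∀ a ∈ L, ‖a.2‖ ≤ C / (A * N) := by
    intro a ha
    rw [hL, List.mem_flatten] at ha
    obtain ⟨l, hl, hal⟩ := ha
    rw [List.eq_of_mem_replicate hl] at hal
    exact (norm_coeff_le_coeffSum hal).trans hq'M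
  have hLlen : (L.length : ℝ) ≤ A * (N + 1) * J := by
    have : L.length = K * q.length := by simp [hL, hq']
    rw [this]
    push_cast
    gcongr
    linarith
  obtain ⟨B, E, hE, hμE, hsep, hpr, hap, hpar⟩ :=
    exists_block_of_list μ hμ hv hA hε'0 hs hψ0 hψ hp hAψ L hLM prior
  -- A far frequency with coefficient zero is appended so that the block is nonempty even when `q`
  -- is; this later makes the block boundaries strictly increasing.
  obtain ⟨w, hw⟩ := exists_far_vector hv (prior ++ B.map Prod.fst)
  have hBt : ∀ t, trig (B ++ [(w, 0)]) t = trig B t := by intro t; simp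
  have hεc : ε' * coeffSum L ≤ ε / 4 := le_trans (by gcongr) hε'1
  have hap' : ∀ t ∉ E, ‖trig (B ++ [(w, 0)]) t - trig q t‖ ≤ ε := by
    intro t ht
    rw [hBt, ← hLt]
    exact (hap t ht).trans (by linarith)
  refine ⟨B ++ [(w, 0)], E, by simp, hE, hμE.trans (ENNReal.ofReal_le_ofReal ?_), ?_, ?_, hap', ?_⟩
  · calc L.length * (2 * ε' / A) ≤ A * (N + 1) * J * (2 * ε' / A) := by gcongr
      _ = (N + 1) * J * 2 * ε' := by field_simp
      _ ≤ ε := hε'2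
  · rw [List.map_append, List.pairwise_append]
    refine ⟨hsep, by simp, ?_⟩
    intro x hx y hy
    simp only [List.map_cons, List.map_nil, List.mem_singleton] at hy
    rw [hy]
    exact hw x (List.mem_append_right _ hx)
  · intro x hx y hy
    rw [List.map_append, List.mem_append] at hy
    rcases hy with hy | hy
    · exact hpr x hx y hy
    · simp only [List.map_cons, List.map_nil, List.mem_singleton] at hy
      rw [hy]
      exact hw x (List.mem_append_left _ hx)
  · intro m
    obtain ⟨r, hr⟩ := hpar m
    obtain ⟨k, hk, j, hkj⟩ := trig_take_flatten_replicate q' K r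
    refine ⟨k / K, by positivity, div_le_one_of_le₀ (by exact_mod_cast hk) hK0.le, ?_⟩
    have htake : ∀ t, trig ((B ++ [(w, 0)]).take m) t = trig (B.take m) t := by
      intro t
      rw [List.take_append, trig_append]
      rcases m - B.length with _ | n <;> simp
    have heq : (fun t => trig ((B ++ [(w, 0)]).take m) t - ((k / K : ℝ) : ℂ) * trig q t)
        = (fun t => trig (B.take m) t - trig (L.take r) t) + fun t => trig (q'.take j) t := by
      ext t
      rw [htake, Pi.add_apply, hL, hkj, hq't]
      push_cast
      ring
    rw [heq]
    refine (eLpNorm_add_le ?_ ?_ (by norm_num)).trans ?_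
    · exact ((continuous_trig _).sub (continuous_trig _)).aestronglyMeasurable
    · exact (continuous_trig _).aestronglyMeasurable
    · have hCAN : C / (A * N) ≤ C / N := by
        gcongr
        nlinarith
      have h1 : eLpNorm (fun t => trig (q'.take j) t) 2 (μ.restrict Eᶜ)
          ≤ ENNReal.ofReal (ε / 12) :=
        eLpNorm_two_restrict_le hE.compl fun t _ =>
          (norm_trig_le _ _).trans ((coeffSum_take_le _ _).trans
            (hq'M.trans (hCAN.trans hCN)))
      refine (add_le_add hr h1).trans ?_
      rw [← ENNReal.ofReal_add (by positivity) (by positivity)]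
      apply ENNReal.ofReal_le_ofReal
      have : C / (A * N) * (2 * A) = 2 * (C / N) := by field_simp
      rw [this]
      linarith

/-! ### Concatenation of the blocks and the weight -/

theorem trig_map_range (Λ : ℕ → RSpace d × ℂ) (n : ℕ) (t : RSpace d) :
    trig ((List.range n).map Λ) t = ∑ k ∈ Finset.range n, (Λ k).2 * expo (Λ k).1 t := by
  induction n with
  | zero => simp
  | succ n ih => rw [List.range_succ, List.map_append, trig_append, ih, Finset.sum_range_succ]; simp

/-- A weight which is very small on an exceptional set makes its contribution negligible. -/
theorem eLpNorm_withDensity_le {α F : Type*} [MeasurableSpace α] {μ : Measure α}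
    [IsProbabilityMeasure μ] [NormedAddCommGroup F] {f : α → F} {h : α → ENNReal}
    (hf : AEStronglyMeasurable f μ) (hh : Measurable h) (h1 : ∀ x, h x ≤ 1) {E : Set α}
    (hE : MeasurableSet E) {η D ε : ℝ} (hη : 0 ≤ η) (hε : 0 ≤ ε) (hD : 0 ≤ D)
    (hhE : ∀ x ∈ E, h x ≤ ENNReal.ofReal η) (hfD : ∀ x, ‖f x‖ ≤ D) (hDη : D ^ 2 * η ≤ ε ^ 2)
    (hfE : eLpNorm f 2 (μ.restrict Eᶜ) ≤ ENNReal.ofReal ε) :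
    eLpNorm f 2 (μ.withDensity h) ≤ ENNReal.ofReal (2 * ε) := by
  refine (ENNReal.pow_le_pow_left_iff (n := 2) (by norm_num)).1 ?_
  rw [eLpNorm_two_sq, lintegral_withDensity_eq_lintegral_mul₀ hh.aemeasurable
    (by fun_prop), ← lintegral_add_compl _ hE]
  have hE1 : ∫⁻ x in E, (h * fun x => ‖f x‖ₑ ^ 2) x ∂μ ≤ ENNReal.ofReal (ε ^ 2) := by
    calc ∫⁻ x in E, (h * fun x => ‖f x‖ₑ ^ 2) x ∂μ
        ≤ ∫⁻ x in E, ENNReal.ofReal (ε ^ 2) ∂μ := by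
          refine setLIntegral_mono' hE fun x hx => ?_
          calc h x * ‖f x‖ₑ ^ 2 ≤ ENNReal.ofReal η * ENNReal.ofReal D ^ 2 := by
                gcongr
                · exact hhE x hx
                · rw [← ofReal_norm]
                  exact ENNReal.ofReal_le_ofReal (hfD x)
            _ = ENNReal.ofReal (D ^ 2 * η) := by
                rw [← ENNReal.ofReal_pow hD, ← ENNReal.ofReal_mul hη, mul_comm]
            _ ≤ _ := ENNReal.ofReal_le_ofReal hDη
      _ ≤ ENNReal.ofReal (ε ^ 2) * 1 := by
          rw [setLIntegral_const]
          gcongr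
          exact prob_le_one
      _ = _ := mul_one _
  have hE2 : ∫⁻ x in Eᶜ, (h * fun x => ‖f x‖ₑ ^ 2) x ∂μ ≤ ENNReal.ofReal (ε ^ 2) := by
    calc ∫⁻ x in Eᶜ, (h * fun x => ‖f x‖ₑ ^ 2) x ∂μ ≤ ∫⁻ x in Eᶜ, ‖f x‖ₑ ^ 2 ∂μ := by
          refine lintegral_mono fun x => ?_
          exact mul_le_of_le_one_left zero_le (h1 x)
      _ = eLpNorm f 2 (μ.restrict Eᶜ) ^ 2 := (eLpNorm_two_sq f).symm
      _ ≤ ENNReal.ofReal ε ^ 2 := by gcongr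
      _ = _ := (ENNReal.ofReal_pow hε 2).symm
  refine (add_le_add hE1 hE2).trans ?_
  rw [← ENNReal.ofReal_add (by positivity) (by positivity), ← ENNReal.ofReal_pow (by positivity)]
  apply ENNReal.ofReal_le_ofReal
  nlinarith [sq_nonneg ε]

theorem iInf_ite_ne_zero {f : ℕ → ENNReal} (hf : ∀ i, f i ≠ 0) {P : ℕ → Prop} [DecidablePred P]
    (hP : ∀ᶠ i in atTop, ¬ P i) : (⨅ i, if P i then f i else 1) ≠ 0 := by
  obtain ⟨n, hn⟩ := eventually_atTop.1 hP
  have hc : 0 < min 1 ((Finset.range n).inf f) := by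
    refine lt_min one_pos ?_
    rw [Finset.lt_inf_iff ENNReal.zero_lt_top]
    exact fun i _ => pos_iff_ne_zero.2 (hf i)
  refine (hc.trans_le (le_iInf fun i => ?_)).ne'
  split_ifs with h
  · refine (min_le_right _ _).trans (Finset.inf_le ?_)
    rw [Finset.mem_range]
    by_contra hi
    exact hn i (not_lt.1 hi) h
  · exact min_le_left _ _

/-- Lists obtained by repeatedly appending blocks are initial segments of a sequence. -/
theorem exists_seq_of_append {α : Type*} [Inhabited α] (L b : ℕ → List α)
    (hL : ∀ i, L (i + 1) = L i ++ b i) (hb : ∀ i, b i ≠ []) :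
    ∃ Λ : ℕ → α, ∀ i, L i = (List.range (L i).length).map Λ := by
  have hlen : ∀ i, i ≤ (L i).length := by
    intro i
    induction i with
    | zero => simp
    | succ i ih =>
      rw [hL, List.length_append]
      have := List.length_pos_of_ne_nil (hb i)
      omega
  have hpre : ∀ i j, i ≤ j → L i <+: L j := by
    intro i j hij
    induction hij with
    | refl => exact List.prefix_rfl
    | step _ ih => exact ih.trans (by rw [hL]; exact List.prefix_append _ _)
  -- The default value is never taken, since `L (n + 1)` has more than `n` entries.
  refine ⟨fun n => (L (n + 1)).getD n default, fun i => ?_⟩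
  refine List.ext_getElem (by simp) fun n h1 h2 => ?_
  rw [List.getElem_map, List.getElem_range, List.getD_eq_getElem _ _ (hlen (n + 1))]
  rcases le_total i (n + 1) with h | h
  · exact (hpre _ _ h).getElem h1
  · exact ((hpre _ _ h).getElem (hlen (n + 1))).symm

/-- Blocks are chosen recursively, each with all earlier frequencies as `prior` and tolerance `(1 /
4) ^ i`. The weight comes afterwards, once the exceptional sets and the size of the errors on them
are known. -/
theorem exists_frequencies_and_weight (hd : 1 ≤ d) (μ : Measure (RSpace d))
    [IsProbabilityMeasure μ] (hμ : μ ≪ volume) (q : ℕ → List (RSpace d × ℂ)) :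
    ∃ (Λ : ℕ → RSpace d × ℂ) (a : ℕ → ℕ) (h : RSpace d → ENNReal),
      StrictMono a ∧ a 0 = 0 ∧ (∀ n m, n ≠ m → 1 ≤ ‖(Λ m).1 - (Λ n).1‖) ∧
      Measurable h ∧ (∀ t, h t ≤ 1) ∧ (∀ᵐ t ∂μ, h t ≠ 0) ∧
      (∀ i m, a i ≤ m → m ≤ a (i + 1) → ∃ θ : ℝ, 0 ≤ θ ∧ θ ≤ 1 ∧
        eLpNorm (fun t => ∑ n ∈ Finset.Ico (a i) m, (Λ n).2 * expo (Λ n).1 t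
          - θ * trig (q i) t) 2 (μ.withDensity h) ≤ ENNReal.ofReal (2 * (1 / 4) ^ i)) ∧
      (∀ i, eLpNorm (fun t => ∑ n ∈ Finset.Ico (a i) (a (i + 1)), (Λ n).2 * expo (Λ n).1 t
          - trig (q i) t) 2 (μ.withDensity h) ≤ ENNReal.ofReal (2 * (1 / 4) ^ i)) := by
  classical
  have hε : ∀ i : ℕ, (0 : ℝ) < (1 / 4) ^ i := fun i => by positivity
  choose B E hB hE hμE hsep hpr hap hpar using
    fun (i : ℕ) (prior : List (RSpace d)) => exists_block hd μ hμ (q i) (hε i) prior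
  let L : ℕ → List (RSpace d × ℂ) := fun i =>
    Nat.rec [] (fun i l => l ++ B i (l.map Prod.fst)) i
  have hL0 : L 0 = [] := rfl
  set b : ℕ → List (RSpace d × ℂ) := fun i => B i ((L i).map Prod.fst) with hb
  set e : ℕ → Set (RSpace d) := fun i => E i ((L i).map Prod.fst) with he
  have hLs : ∀ i, L (i + 1) = L i ++ b i := fun i => rfl
  clear_value L
  obtain ⟨Λ, hΛ⟩ := exists_seq_of_append L b hLs fun i => hB _ _
  have hLsep : ∀ i, ((L i).map Prod.fst).Pairwise (fun x y => 1 ≤ ‖x - y‖) := by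
    intro i
    induction i with
    | zero => simp [hL0]
    | succ i ih =>
      rw [hLs, List.map_append, List.pairwise_append]
      exact ⟨ih, hsep _ _, hpr _ _⟩
  set a : ℕ → ℕ := fun i => (L i).length with ha
  have has : ∀ i, a (i + 1) = a i + (b i).length := by
    intro i
    simp only [ha]
    rw [hLs, List.length_append]
  have hmono : StrictMono a := by
    refine strictMono_nat_of_lt_succ fun i => ?_
    rw [has]
    have := List.length_pos_of_ne_nil (hB i ((L i).map Prod.fst))
    change a i < a i + (B i ((L i).map Prod.fst)).length
    omega
  have hlt : ∀ n m, n < m → 1 ≤ ‖(Λ n).1 - (Λ m).1‖ := by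
    intro n m hnm
    have hm : m < a (m + 1) := (Nat.lt_succ_self m).trans_le hmono.le_apply
    have h1 := hLsep (m + 1)
    rw [hΛ (m + 1), List.map_map, List.pairwise_map, List.pairwise_iff_getElem] at h1
    have h2 := h1 n m (by simpa using hnm.trans hm) (by simpa using hm) hnm
    simpa using h2
  have hblock : ∀ i m, a i ≤ m → m ≤ a (i + 1) → ∀ t,
      ∑ n ∈ Finset.Ico (a i) m, (Λ n).2 * expo (Λ n).1 t = trig ((b i).take (m - a i)) t := by
    intro i m h1 h2 t
    have h3 : (L (i + 1)).take m = (List.range m).map Λ := by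
      rw [hΛ (i + 1), ← List.map_take, List.take_range]
      congr 2
      exact min_eq_left h2
    have h4 : (L (i + 1)).take m = L i ++ (b i).take (m - a i) := by
      rw [hLs, List.take_append, List.take_of_length_le h1]
    have h5 : trig (L i) t = ∑ n ∈ Finset.range (a i), (Λ n).2 * expo (Λ n).1 t := by
      rw [← trig_map_range, ← hΛ i]
    have h6 := congrArg (fun l => trig l t) (h3.symm.trans h4)
    simp only [trig_append] at h6
    rw [trig_map_range, h5, ← Finset.sum_range_add_sum_Ico _ h1] at h6
    exact add_left_cancel h6
  set D : ℕ → ℝ := fun i => coeffSum (b i) + coeffSum (q i) with hD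
  have hD0 : ∀ i, 0 ≤ D i := fun i => add_nonneg (coeffSum_nonneg _) (coeffSum_nonneg _)
  -- `D i` bounds the error of block `i` everywhere; `η i` is chosen so that `D i ^ 2 * η i` is at
  -- most the square of the tolerance.
  set η : ℕ → ℝ := fun i => ((1 / 4) ^ i) ^ 2 / (D i ^ 2 + 1) with hη
  have hη0 : ∀ i, 0 < η i := fun i => by
    have := hε i
    simp only [hη]
    positivity
  have hη1 : ∀ i, η i ≤ 1 := fun i => by
    simp only [hη]
    rw [div_le_one (by positivity)]
    have : ((1 / 4 : ℝ) ^ i) ^ 2 ≤ 1 :=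
      pow_le_one₀ (by positivity) (pow_le_one₀ (by norm_num) (by norm_num))
    nlinarith [sq_nonneg (D i)]
  have hDη : ∀ i, D i ^ 2 * η i ≤ ((1 / 4) ^ i) ^ 2 := fun i => by
    simp only [hη]
    rw [mul_div_assoc', div_le_iff₀ (by positivity)]
    nlinarith [sq_nonneg ((1 / 4 : ℝ) ^ i)]
  set h : RSpace d → ENNReal := fun t => ⨅ i, if t ∈ e i then ENNReal.ofReal (η i) else 1 with hh
  have hem : ∀ i, MeasurableSet (e i) := fun i => hE _ _
  have hhm : Measurable h := by
    refine Measurable.iInf fun i => ?_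
    exact Measurable.ite (hem i) measurable_const measurable_const
  have hh1 : ∀ t, h t ≤ 1 := by
    intro t
    refine (iInf_le _ 0).trans ?_
    split_ifs
    · exact ENNReal.ofReal_le_one.2 (hη1 0)
    · exact le_rfl
  have hhe : ∀ i, ∀ t ∈ e i, h t ≤ ENNReal.ofReal (η i) := by
    intro i t ht
    refine (iInf_le _ i).trans ?_
    rw [if_pos ht]
  have hpos : ∀ᵐ t ∂μ, h t ≠ 0 := by
    -- By Borel–Cantelli almost every `t` lies in finitely many `e i`, so the infimum defining `h t`
    -- has only finitely many values below `1`, all positive.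
    have hs : ∑' i, μ (e i) ≠ ⊤ := by
      refine ne_top_of_le_ne_top ?_ (ENNReal.tsum_le_tsum fun i => hμE i _)
      exact (summable_geometric_of_lt_one (by norm_num) (by norm_num)).tsum_ofReal_ne_top
    filter_upwards [ae_eventually_notMem hs] with t ht
    exact iInf_ite_ne_zero (fun i => (ENNReal.ofReal_pos.2 (hη0 i)).ne') ht
  have hfinal : ∀ i (c : ℂ) j, ‖c‖ ≤ 1 → eLpNorm (fun t => trig ((b i).take j) t
      - c * trig (q i) t) 2 (μ.restrict (e i)ᶜ) ≤ ENNReal.ofReal ((1 / 4) ^ i) →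
      eLpNorm (fun t => trig ((b i).take j) t - c * trig (q i) t) 2 (μ.withDensity h)
        ≤ ENNReal.ofReal (2 * (1 / 4) ^ i) := by
    intro i c j hc hle
    refine eLpNorm_withDensity_le
      ((continuous_trig _).sub (continuous_const.mul (continuous_trig _))).aestronglyMeasurable
      hhm hh1 (hem i) (hη0 i).le (hε i).le (hD0 i) (hhe i) (fun t => ?_) (hDη i) hle
    refine (norm_sub_le _ _).trans (add_le_add ?_ ?_)
    · exact (norm_trig_le _ _).trans (coeffSum_take_le _ _)
    · change ‖c * trig (q i) t‖ ≤ _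
      rw [norm_mul]
      exact (mul_le_of_le_one_left (norm_nonneg _) hc).trans (norm_trig_le _ _)
  refine ⟨Λ, a, h, hmono, by simp [ha, hL0], ?_, hhm, hh1, hpos, ?_, ?_⟩
  · intro n m hnm
    rcases lt_or_gt_of_ne hnm with h1 | h1
    · rw [norm_sub_rev]; exact hlt n m h1
    · exact hlt m n h1
  · intro i m h1 h2
    obtain ⟨θ, hθ0, hθ1, hθ⟩ := hpar i ((L i).map Prod.fst) (m - a i)
    refine ⟨θ, hθ0, hθ1, ?_⟩
    simp_rw [hblock i m h1 h2]
    refine hfinal i θ _ ?_ hθ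
    rw [Complex.norm_real, Real.norm_of_nonneg hθ0]
    exact hθ1
  · intro i
    simp_rw [hblock i _ (hmono.monotone (Nat.le_succ i)) le_rfl]
    have h1 := hfinal i 1 (a (i + 1) - a i) (by simp)
    simp only [one_mul] at h1
    apply h1
    refine eLpNorm_two_restrict_le (hem i).compl fun t ht => ?_
    rw [has, Nat.add_sub_cancel_left, List.take_length]
    exact hap _ _ t ht

/-! ### Modulations, the Fourier transform and density in `L²` -/

theorem memLp_expo_mul (s : RSpace d) (f : L2Space d) :
    MemLp (fun t => expo s t * f t) 2 (volume : Measure (RSpace d)) := by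
  refine (Lp.memLp f).of_le
    ((continuous_expo s).aestronglyMeasurable.mul (Lp.aestronglyMeasurable f))
    (ae_of_all _ fun t => ?_)
  rw [norm_mul, norm_expo, one_mul]

/-- Multiplication of `f ∈ L²` by the exponential of frequency `s`. -/
noncomputable def modulate (s : RSpace d) (f : L2Space d) : L2Space d :=
  (memLp_expo_mul s f).toLp _

theorem coeFn_modulate (s : RSpace d) (f : L2Space d) :
    (modulate s f : RSpace d → ℂ) =ᵐ[volume] fun t => expo s t * f t :=
  MemLp.coeFn_toLp _

theorem isometry_modulate (s : RSpace d) : Isometry (modulate s) := by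
  refine Isometry.of_dist_eq fun f g => ?_
  rw [dist_eq_norm, dist_eq_norm, Lp.norm_def, Lp.norm_def]
  congr 1
  refine eLpNorm_congr_norm_ae ?_
  filter_upwards [Lp.coeFn_sub (modulate s f) (modulate s g), Lp.coeFn_sub f g,
    coeFn_modulate s f, coeFn_modulate s g] with t h1 h2 h3 h4
  rw [h1, h2, Pi.sub_apply, Pi.sub_apply, h3, h4, ← mul_sub, norm_mul, norm_expo, one_mul]

theorem fourierInv_comp_sub_const (a : RSpace d) (f : RSpace d → ℂ) (w : RSpace d) :
    𝓕⁻ (fun x => f (x - a)) w = expo a w * 𝓕⁻ f w := by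
  rw [Real.fourierInv_eq, Real.fourierInv_eq, ← integral_add_right_eq_self _ a,
    ← integral_const_mul]
  refine integral_congr_ae (ae_of_all _ fun x => ?_)
  simp only [add_sub_cancel_right, Circle.smul_def, smul_eq_mul, expo]
  rw [inner_add_left, AddChar.map_add_eq_mul, Circle.coe_mul]
  ring

/-- Both sides are continuous in `f`, so the pointwise computation for Schwartz functions suffices.
-/
theorem fourierInv_translateL2 (a : RSpace d) (f : L2Space d) :
    𝓕⁻ (translateL2 a f) = modulate a (𝓕⁻ f) := by
  have hcl : IsClosed {f : L2Space d | 𝓕⁻ (translateL2 a f) = modulate a (𝓕⁻ f)} := by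
    refine isClosed_eq ?_ ?_
    · exact (Lp.fourierTransformₗᵢ (RSpace d) ℂ).symm.continuous.comp
        (Lp.isometry_compMeasurePreserving (measurePreserving_sub_right volume a)).continuous
    · exact (isometry_modulate a).continuous.comp
        (Lp.fourierTransformₗᵢ (RSpace d) ℂ).symm.continuous
  have hd : DenseRange (SchwartzMap.toLpCLM ℂ (E := RSpace d) ℂ 2 volume) :=
    SchwartzMap.denseRange_toLpCLM ENNReal.ofNat_ne_top
  refine hd.induction_on (p := fun f => 𝓕⁻ (translateL2 a f) = modulate a (𝓕⁻ f)) f hcl ?_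
  intro φ
  have h1 : translateL2 a (φ.toLp 2 volume) = (φ.compSubConstCLM ℂ a).toLp 2 volume := by
    refine Lp.ext ?_
    have h3 := (measurePreserving_sub_right (volume : Measure (RSpace d)) a).quasiMeasurePreserving.ae
      (SchwartzMap.coeFn_toLp φ 2 volume)
    filter_upwards [coeFn_translateL2 a (φ.toLp 2 volume),
      SchwartzMap.coeFn_toLp (φ.compSubConstCLM ℂ a) 2 volume, h3] with x h4 h5 h6
    rw [h4, h5, h6]
    rfl
  change 𝓕⁻ (translateL2 a (φ.toLp 2 volume)) = modulate a (𝓕⁻ (φ.toLp 2 volume))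
  rw [h1, SchwartzMap.toLp_fourierInv_eq, SchwartzMap.toLp_fourierInv_eq]
  refine Lp.ext ?_
  filter_upwards [SchwartzMap.coeFn_toLp (𝓕⁻ (φ.compSubConstCLM ℂ a)) 2 volume,
    coeFn_modulate a ((𝓕⁻ φ).toLp 2 volume),
    SchwartzMap.coeFn_toLp (𝓕⁻ φ) 2 volume] with w h2 h3 h4
  rw [h2, h3, h4, SchwartzMap.fourierInv_coe, SchwartzMap.fourierInv_coe]
  exact fourierInv_comp_sub_const a φ w

/-- The Fourier transform of `k` vanishes. Moving the transform across the integral, `k` annihilates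
every `𝓕 (𝓕⁻ ψ) = ψ` with `ψ` Schwartz, in particular all test functions. -/
theorem ae_eq_zero_of_forall_integral_expo_mul {k : RSpace d → ℂ} (hk : Integrable k)
    (h : ∀ s, ∫ t, expo s t * k t = 0) : k =ᵐ[volume] 0 := by
  have hF : 𝓕 k = 0 := by
    ext w
    rw [Real.fourier_eq, Pi.zero_apply, ← h (-w)]
    refine integral_congr_ae (ae_of_all _ fun t => ?_)
    simp only [Circle.smul_def, smul_eq_mul, expo]
    rw [inner_neg_left, real_inner_comm]
  have hψ : ∀ ψ : 𝓢(RSpace d, ℂ), ∫ t, k t • ψ t = 0 := by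
    intro ψ
    have h1 := VectorFourier.integral_fourierIntegral_smul_eq_flip (μ := volume) (ν := volume)
      (L := innerₗ (RSpace d)) (f := k) (g := ⇑(𝓕⁻ ψ : 𝓢(RSpace d, ℂ))) Real.continuous_fourierChar
      continuous_inner hk (𝓕⁻ ψ : 𝓢(RSpace d, ℂ)).integrable
    have h2 : VectorFourier.fourierIntegral Real.fourierChar volume (innerₗ (RSpace d)) k = 0 := hF
    have h3 : VectorFourier.fourierIntegral Real.fourierChar volume (innerₗ (RSpace d)).flip
        ⇑(𝓕⁻ ψ : 𝓢(RSpace d, ℂ)) = ψ := by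
      rw [flip_innerₗ]
      change 𝓕 ((𝓕⁻ ψ : 𝓢(RSpace d, ℂ)) : RSpace d → ℂ) = ψ
      rw [← SchwartzMap.fourier_coe, FourierTransform.fourier_fourierInv_eq]
    rw [h2, h3] at h1
    simpa using h1.symm
  refine ae_eq_zero_of_integral_contDiff_smul_eq_zero hk.locallyIntegrable ?_
  intro g hg hgc
  have hg₁ : HasCompactSupport (Complex.ofRealCLM ∘ g) := hgc.comp_left rfl
  have hg₂ : ContDiff ℝ ∞ (Complex.ofRealCLM ∘ g) := by fun_prop
  rw [← hψ (hg₁.toSchwartzMap hg₂)]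
  refine integral_congr_ae (ae_of_all _ fun t => ?_)
  simp [mul_comm]

/-- The element of `L²` obtained by multiplying `G` with a trigonometric polynomial. -/
noncomputable def trigMul (G : L2Space d) (L : List (RSpace d × ℂ)) : L2Space d :=
  (L.map fun a => a.2 • modulate a.1 G).sum

theorem coeFn_trigMul (G : L2Space d) (L : List (RSpace d × ℂ)) :
    (trigMul G L : RSpace d → ℂ) =ᵐ[volume] fun t => trig L t * G t := by
  induction L with
  | nil =>
    filter_upwards with t
    simp [trigMul]
  | cons a L ih =>
    have h0 : trigMul G (a :: L) = a.2 • modulate a.1 G + trigMul G L := by simp [trigMul]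
    rw [h0]
    filter_upwards [ih, Lp.coeFn_add (a.2 • modulate a.1 G) (trigMul G L),
      Lp.coeFn_smul a.2 (modulate a.1 G), coeFn_modulate a.1 G] with t h1 h2 h3 h4
    rw [h2, Pi.add_apply, h1, h3, Pi.smul_apply, h4, trig_cons, smul_eq_mul]
    ring

/-- If `f` is orthogonal to all modulations of `G`, the integrable function `conj G * f` has
vanishing Fourier transform, so `f = 0` wherever `G ≠ 0`. -/
theorem exists_trigMul_near {G : L2Space d} (hG : ∀ᵐ t, G t ≠ 0) (f : L2Space d) {ε : ℝ}
    (hε : 0 < ε) : ∃ L, ‖trigMul G L - f‖ < ε := by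
  have htop : (Submodule.span ℂ (Set.range fun s => modulate s G)).topologicalClosure = ⊤ := by
    rw [Submodule.topologicalClosure_eq_top_iff, Submodule.eq_bot_iff]
    intro f hf
    have hint : Integrable fun t => (starRingEnd ℂ) (G t) * f t := by
      have := L2.integrable_inner (𝕜 := ℂ) G f
      simpa [RCLike.inner_apply, mul_comm] using this
    have h0 := ae_eq_zero_of_forall_integral_expo_mul hint fun s => by
      have h1 := (Submodule.mem_orthogonal _ _).1 hf _
        (Submodule.subset_span ⟨-s, rfl⟩)
      rw [L2.inner_def] at h1
      rw [← h1]
      refine integral_congr_ae ?_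
      filter_upwards [coeFn_modulate (-s) G] with t ht
      rw [ht, RCLike.inner_apply, map_mul]
      have : (starRingEnd ℂ) (expo (-s) t) = expo s t := by
        rw [expo, expo, inner_neg_left, AddChar.map_neg_eq_inv, Circle.coe_inv_eq_conj,
          Complex.conj_conj]
      rw [this]
      ring
    refine (Lp.eq_zero_iff_ae_eq_zero).2 ?_
    filter_upwards [h0, hG] with t h1 h2
    simpa [h2] using h1
  have hspan : ∀ g ∈ Submodule.span ℂ (Set.range fun s => modulate s G), ∃ L, trigMul G L = g := by
    intro g hg
    induction hg using Submodule.span_induction with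
    | mem g hg =>
      obtain ⟨s, rfl⟩ := hg
      exact ⟨[(s, 1)], by simp [trigMul]⟩
    | zero => exact ⟨[], by simp [trigMul]⟩
    | add g g' _ _ h1 h2 =>
      obtain ⟨L, rfl⟩ := h1
      obtain ⟨L', rfl⟩ := h2
      exact ⟨L ++ L', by simp [trigMul]⟩
    | smul c g _ h1 =>
      obtain ⟨L, rfl⟩ := h1
      refine ⟨L.map fun a => (a.1, c * a.2), ?_⟩
      rw [trigMul, trigMul, List.smul_sum, List.map_map, List.map_map]
      congr 1
      refine List.map_congr_left fun a _ => ?_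
      simp [mul_smul]
  have hf : f ∈ closure (Submodule.span ℂ (Set.range fun s => modulate s G) : Set (L2Space d)) := by
    have : f ∈ (Submodule.span ℂ (Set.range fun s => modulate s G)).topologicalClosure := by
      rw [htop]; trivial
    exact this
  obtain ⟨g, hg, hfg⟩ := Metric.mem_closure_iff.1 hf ε hε
  obtain ⟨L, rfl⟩ := hspan g hg
  exact ⟨L, by rwa [dist_comm, dist_eq_norm] at hfg⟩

theorem enorm_trigMul_sub (G : L2Space d) (L L' : List (RSpace d × ℂ)) (c : ℂ)
    {w : RSpace d → ENNReal} (hw : Measurable w) (hGw : ∀ᵐ t, ‖G t‖ₑ ^ 2 = w t) :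
    ‖trigMul G L - c • trigMul G L'‖ₑ
      = eLpNorm (fun t => trig L t - c * trig L' t) 2 (volume.withDensity w) := by
  suffices h : ‖trigMul G L - c • trigMul G L'‖ₑ ^ 2
      = eLpNorm (fun t => trig L t - c * trig L' t) 2 (volume.withDensity w) ^ 2 from
    le_antisymm ((ENNReal.pow_le_pow_left_iff two_ne_zero).1 h.le)
      ((ENNReal.pow_le_pow_left_iff two_ne_zero).1 h.ge)
  rw [Lp.enorm_def, eLpNorm_two_sq, eLpNorm_two_sq,
    lintegral_withDensity_eq_lintegral_mul₀ hw.aemeasurable]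
  · refine lintegral_congr_ae ?_
    filter_upwards [hGw, Lp.coeFn_sub (trigMul G L) (c • trigMul G L'),
      Lp.coeFn_smul c (trigMul G L'), coeFn_trigMul G L, coeFn_trigMul G L'] with t h1 h2 h3 h4 h5
    rw [h2, Pi.sub_apply, h3, Pi.smul_apply, h4, h5, Pi.mul_apply, ← h1, ← mul_pow, ← enorm_mul,
      smul_eq_mul]
    congr 2
    ring
  · have := continuous_trig L
    have := continuous_trig L'
    fun_prop

/-- An `L²` function whose squared modulus is a given integrable density. -/
theorem exists_L2_of_density {w : RSpace d → ENNReal} (hw : Measurable w)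
    (hfin : ∫⁻ t, w t ≠ ⊤) : ∃ G : L2Space d, ∀ᵐ t, ‖G t‖ₑ ^ 2 = w t := by
  set F : RSpace d → ℂ := fun t => ((Real.sqrt (w t).toReal : ℝ) : ℂ) with hF
  have hFm : Measurable F :=
    Complex.measurable_ofReal.comp (Real.continuous_sqrt.measurable.comp hw.ennreal_toReal)
  have hFw : ∀ᵐ t, ‖F t‖ₑ ^ 2 = w t := by
    filter_upwards [ae_lt_top hw hfin] with t ht
    rw [← ofReal_norm, ← ENNReal.ofReal_pow (norm_nonneg _)]
    simp only [hF]
    rw [Complex.norm_real, Real.norm_of_nonneg (Real.sqrt_nonneg _),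
      Real.sq_sqrt ENNReal.toReal_nonneg, ENNReal.ofReal_toReal ht.ne]
  have hmem : MemLp F 2 (volume : Measure (RSpace d)) := by
    refine ⟨hFm.aestronglyMeasurable, ?_⟩
    have h1 : eLpNorm F 2 (volume : Measure (RSpace d)) ^ 2 < ⊤ := by
      rw [eLpNorm_two_sq, lintegral_congr_ae hFw]
      exact hfin.lt_top
    exact (ENNReal.pow_lt_top_iff.1 h1).resolve_right two_ne_zero
  refine ⟨hmem.toLp F, ?_⟩
  filter_upwards [hFw, hmem.coeFn_toLp] with t h1 h2
  rw [h2, h1]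

/-- A sequence of trigonometric polynomials, each repeated infinitely often, which is dense among
all of them in the norm of `L²(μ)`. -/
theorem exists_dense_seq_trig (μ : Measure (RSpace d)) [IsProbabilityMeasure μ] :
    ∃ q : ℕ → List (RSpace d × ℂ), ∀ L, ∀ ε : ENNReal, 0 < ε →
      ∃ᶠ i in atTop, eLpNorm (fun t => trig (q i) t - trig L t) 2 μ < ε := by
  have hmem : ∀ L : List (RSpace d × ℂ), MemLp (trig L) 2 μ := fun L =>
    MemLp.of_bound (continuous_trig L).aestronglyMeasurable (coeffSum L)
      (ae_of_all _ fun t => norm_trig_le L t)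
  set Φ : List (RSpace d × ℂ) → Lp ℂ 2 μ := fun L => (hmem L).toLp _ with hΦ
  have : Nonempty (Set.range Φ) := ⟨⟨_, [], rfl⟩⟩
  have : Fact ((2 : ENNReal) ≠ ⊤) := ⟨by norm_num⟩
  have hchoose : ∀ i, ∃ L, Φ L = (TopologicalSpace.denseSeq (Set.range Φ) i : Lp ℂ 2 μ) :=
    fun i => (TopologicalSpace.denseSeq (Set.range Φ) i).2
  choose q₀ hq₀ using hchoose
  -- Unpairing repeats every index infinitely often.
  refine ⟨fun n => q₀ n.unpair.1, fun L ε hε => ?_⟩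
  obtain ⟨i, hi⟩ : ∃ i, eLpNorm (fun t => trig (q₀ i) t - trig L t) 2 μ < ε := by
    have hd := TopologicalSpace.denseRange_denseSeq (Set.range Φ)
    obtain ⟨i, hi⟩ := hd.exists_mem_open (s := Metric.eball (⟨Φ L, L, rfl⟩ : Set.range Φ) ε)
      Metric.isOpen_eball ⟨_, Metric.mem_eball_self hε⟩
    refine ⟨i, ?_⟩
    rw [Metric.mem_eball, Subtype.edist_eq, ← hq₀, hΦ, Lp.edist_toLp_toLp] at hi
    exact hi
  rw [frequently_atTop]
  intro N
  refine ⟨Nat.pair i N, Nat.right_le_pair i N, ?_⟩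
  simpa only [Nat.unpair_pair] using hi

/-! ### Assembly and return to translates -/

theorem exists_modulations_isSchauderFrame (hd : 1 ≤ d) :
    ∃ (lam : ℕ → RSpace d) (G : L2Space d) (y : ℕ → L2Space d),
      UniformlyDiscrete lam ∧ IsSchauderFrame (fun n => modulate (lam n) G) y := by
  have : Fact ((2 : ENNReal) ≠ ⊤) := ⟨by norm_num⟩
  -- A probability measure with the same null sets as Lebesgue measure.
  set μ : Measure (RSpace d) := (volume : Measure (RSpace d)).toFinite with hμdef
  have hμv : μ ≪ volume := toFinite_absolutelyContinuous _
  have hvμ : (volume : Measure (RSpace d)) ≪ μ := absolutelyContinuous_toFinite _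
  -- The targets `q` must be fixed before the weight `h` is known. Approximation in `L²(μ)` is
  -- enough, because `h ≤ 1` makes the weighted norm smaller.
  obtain ⟨q, hq⟩ := exists_dense_seq_trig μ
  obtain ⟨Λ, a, h, ha, ha0, hsep, hh, hh1, hpos, hpart, hfull⟩ :=
    exists_frequencies_and_weight hd μ hμv q
  -- `w` is the Lebesgue density of `h μ`, so that `|G|² = w` makes `L ↦ trigMul G L`
  -- norm-preserving from `L²(h μ)` to `L²`.
  set w : RSpace d → ENNReal := μ.rnDeriv volume * h with hw
  have hwm : Measurable w := (Measure.measurable_rnDeriv _ _).mul hh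
  have hμw : μ.withDensity h = volume.withDensity w := by
    rw [hw, withDensity_mul _ (Measure.measurable_rnDeriv _ _) hh,
      Measure.withDensity_rnDeriv_eq _ _ hμv]
  have hle : μ.withDensity h ≤ μ := by
    calc μ.withDensity h ≤ μ.withDensity 1 := withDensity_mono (ae_of_all _ hh1)
      _ = μ := withDensity_one
  have hwfin : ∫⁻ t, w t ≠ ⊤ := by
    have h1 : ∫⁻ t, w t = (volume.withDensity w) Set.univ := by
      rw [withDensity_apply _ MeasurableSet.univ, Measure.restrict_univ]
    rw [h1, ← hμw]
    exact ne_top_of_le_ne_top (measure_ne_top μ Set.univ) (hle Set.univ)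
  obtain ⟨G, hG⟩ := exists_L2_of_density hwm hwfin
  have hG0 : ∀ᵐ t, G t ≠ 0 := by
    have h1 : ∀ᵐ t, μ.rnDeriv volume t ≠ 0 := by
      filter_upwards [hvμ.ae_le (Measure.rnDeriv_pos hμv)] with t ht
      exact ht.ne'
    filter_upwards [hG, h1, hvμ.ae_le hpos] with t h2 h3 h4 h5
    rw [h5] at h2
    have : w t ≠ 0 := mul_ne_zero h3 h4
    apply this
    rw [← h2]
    simp
  have hnorm : ∀ L L' c, ‖trigMul G L - c • trigMul G L'‖ₑ
      = eLpNorm (fun t => trig L t - c * trig L' t) 2 (μ.withDensity h) := by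
    intro L L' c
    rw [hμw]
    exact enorm_trigMul_sub G L L' c hwm hG
  have hnorm1 : ∀ L L', ‖trigMul G L - trigMul G L'‖ₑ
      = eLpNorm (fun t => trig L t - trig L' t) 2 (μ.withDensity h) := by
    intro L L'
    simpa using hnorm L L' 1
  set l : ℕ → ℕ → List (RSpace d × ℂ) := fun i m => (List.range (m - i)).map fun k => Λ (i + k)
    with hl
  have hltrig : ∀ i m t, trig (l i m) t = ∑ n ∈ Finset.Ico i m, (Λ n).2 * expo (Λ n).1 t := by
    intro i m t
    rw [hl, trig_map_range, Finset.sum_Ico_eq_sum_range]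
  have hlmul : ∀ i m, trigMul G (l i m)
      = ∑ n ∈ Finset.Ico i m, (Λ n).2 • modulate (Λ n).1 G := by
    intro i m
    rw [hl, Finset.sum_Ico_eq_sum_range, trigMul, List.map_map]
    rfl
  have hpow : ∀ i : ℕ, (0 : ℝ) ≤ 2 * (1 / 4) ^ i := fun i => by positivity
  suffices hy : ∃ y, IsSchauderFrame (fun n => modulate (Λ n).1 G) y by
    obtain ⟨y, hy⟩ := hy
    exact ⟨fun n => (Λ n).1, G, y, ⟨1, one_pos, hsep⟩, hy⟩
  refine exists_isSchauderFrame_of_blocks (fun n => modulate (Λ n).1 G)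
    (fun n => (Λ n).2) a ha ha0 (fun i => trigMul G (q i)) ?_ ?_ ?_
  · intro i m h1 h2
    obtain ⟨θ, hθ0, hθ1, hθ⟩ := hpart i m h1 h2
    rw [← hlmul]
    simp_rw [← hltrig] at hθ
    rw [← hnorm, ← ofReal_norm, ENNReal.ofReal_le_ofReal_iff (hpow i)] at hθ
    have h3 : (2 : ℝ) * (1 / 4) ^ i ≤ 2 := by
      have : (1 / 4 : ℝ) ^ i ≤ 1 := pow_le_one₀ (by norm_num) (by norm_num)
      linarith
    have h4 : ‖(θ : ℂ) • trigMul G (q i)‖ ≤ ‖trigMul G (q i)‖ := by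
      rw [norm_smul, Complex.norm_real, Real.norm_of_nonneg hθ0]
      exact mul_le_of_le_one_left (norm_nonneg _) hθ1
    calc ‖trigMul G (l (a i) m)‖
        = ‖(θ : ℂ) • trigMul G (q i) + (trigMul G (l (a i) m) - (θ : ℂ) • trigMul G (q i))‖ := by
          rw [add_sub_cancel]
      _ ≤ _ := norm_add_le _ _
      _ ≤ _ := by linarith
  · refine squeeze_zero_norm (a := fun i : ℕ => (2 : ℝ) * (1 / 4) ^ i) (fun i => ?_) ?_
    · have h1 := hfull i
      simp_rw [← hltrig] at h1
      rw [← hnorm1, ← ofReal_norm, ENNReal.ofReal_le_ofReal_iff (hpow i)] at h1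
      rw [← hlmul]
      exact h1
    · have := (tendsto_pow_atTop_nhds_zero_of_lt_one (r := (1 / 4 : ℝ)) (by norm_num)
        (by norm_num)).const_mul 2
      simpa using this
  · intro v ε hε
    obtain ⟨L, hL⟩ := exists_trigMul_near hG0 v (half_pos hε)
    refine (hq L (ENNReal.ofReal (ε / 2)) (by positivity)).mono fun i hi => ?_
    have h1 : ‖trigMul G (q i) - trigMul G L‖ₑ < ENNReal.ofReal (ε / 2) := by
      rw [hnorm1]
      exact (eLpNorm_mono_measure _ hle).trans_lt hi
    rw [← ofReal_norm, ENNReal.ofReal_lt_ofReal_iff (by positivity)] at h1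
    calc ‖trigMul G (q i) - v‖
        = ‖(trigMul G (q i) - trigMul G L) + (trigMul G L - v)‖ := by rw [sub_add_sub_cancel]
      _ ≤ _ := norm_add_le _ _
      _ < ε := by linarith

theorem IsSchauderFrame.map {H K : Type*} [NormedAddCommGroup H] [InnerProductSpace ℂ H]
    [NormedAddCommGroup K] [InnerProductSpace ℂ K] {x y : ℕ → H} (h : IsSchauderFrame x y)
    (T : H ≃ₗᵢ[ℂ] K) : IsSchauderFrame (fun n => T (x n)) (fun n => T (y n)) := by
  intro f
  have h1 := (T.continuous.tendsto _).comp (h (T.symm f))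
  rw [T.apply_symm_apply] at h1
  refine h1.congr fun N => ?_
  simp only [Function.comp, map_sum, map_smul]
  refine Finset.sum_congr rfl fun n _ => ?_
  rw [← T.inner_map_map, T.apply_symm_apply]

theorem theorem4p1 (d : ℕ) (hd : 1 ≤ d) :
    ∃ (lam : ℕ → RSpace d) (g : L2Space d) (gstar : ℕ → L2Space d),
      UniformlyDiscrete lam ∧ IsSchauderFrame (fun n => translateL2 (lam n) g) gstar := by
  obtain ⟨lam, G, y, hlam, hy⟩ := exists_modulations_isSchauderFrame hd
  set T := Lp.fourierTransformₗᵢ (RSpace d) ℂ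
  refine ⟨lam, T G, fun n => T (y n), hlam, ?_⟩
  have hT : ∀ a, T (modulate a G) = translateL2 a (T G) := by
    intro a
    have h1 : T.symm (translateL2 a (T G)) = modulate a (T.symm (T G)) :=
      fourierInv_translateL2 a (T G)
    rw [T.symm_apply_apply] at h1
    rw [← h1, T.apply_symm_apply]
  simp_rw [← hT]
  exact hy.map T
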